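/- **Setting.** Let $G^*=\{G_1,\dots,G_K\}$ be a partition of $[p]=\{1,\dots,p\}$, and let $m=\min_k|G_k|$. A random vector $X\in\mathbb R^p$ has a Gaussian latent decomposition with respect to $G^*$ if $X$ is Gaussian and $X_a=Z_k+E_a$ for all $a\in G_k$ and all $k$. Here $Z\in\mathbb R^K$ and $E\in\mathbb R^p$ are independent, centered and square integrable, the entries of $E$ are independent, and $\mathrm{Var}(E_a)=\mathrm{Var}(E_b)$ whenever $a,b$ are in the same group. Put $C^*=\mathrm{Cov}(Z)$, $\Gamma=\mathrm{Cov}(E)$ (a diagonal matrix), and $$\Delta(C^*)=\min_{j<k}\left(C^*_{kk}+C^*_{jj}-2C^*_{jk}\right)\qquad(=+\infty\text{ if }K=1).$$ Let $|A|_\infty=\max_{a,b}|A_{ab}|$ and $\langle A,B\rangle=\sum_{a,b}A_{ab}B_{ab}$. Let $B^*_{ab}=1/|G_k|$ if $a,b$ are in the same group $G_k$, and $B^*_{ab}=0$ otherwise. **Estimator.** Let $X^{(1)},\dots,X^{(n)}$ be i.i.d. copies of $X$, let $\mathbf X$ be the $n\times p$ matrix with rows $X^{(i)}$ and columns $\mathbf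 X_{:a}$, and let $\widehat\Sigma=\frac1n\mathbf X^t\mathbf X$. For $a\ne b$ put, with the convention $0/0=0$, $$V(a,b)=\max_{c,d\in[p]\setminus\{a,b\}}\left|\left\langle \mathbf X_{:a}-\mathbf X_{:b},\frac{\mathbf X_{:c}-\mathbf X_{:d}}{|\mathbf X_{:c}-\mathbf X_{:d}|_2}\right\rangle\right|.$$ Let $ne_1(a)\in\operatorname{argmin}_{b\in[p]\setminus\{a\}}V(a,b)$ and $ne_2(a)\in\operatorname{argmin}_{b\in[p]\setminus\{a,ne_1(a)\}}V(a,b)$, with ties broken arbitrarily. Let $\widehat\Gamma$ be the diagonal matrix with $$\widehat\Gamma_{aa}=\frac1n\left\langle\mathbf X_{:a}-\mathbf X_{:ne_1(a)},\ \mathbf X_{:a}-\mathbf X_{:ne_2(a)}\right\rangle ,$$ and let $\widehat\kappa=5|\widehat\Gamma|_\infty\left(\sqrt{p/n}+p/n\right)$. Finally, let $$\widehat B_{adapt}\in\operatorname*{argmax}_{B\in\mathcal C_0}\ \langle\widehat\Sigma-\widehat\Gamma,B\rangle-\widehat\kappa\,\mathrm{tr}(B),$$ where $\mathcal C_0$ is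 the set of symmetric positive semidefinite $B\in\mathbb R^{p\times p}$ with $B_{ab}\ge0$ for all $a,b$ and $\sum_aB_{ab}=1$ for all $b$. The definition of $\widehat B_{adapt}$ does not involve $K$. **Statement.** There exist positive numerical constants $c_1,c_2,c_3$ such that the following holds for all $n$, $p$, $K$, all partitions $G^*$ and all $X$ as above. If $m\ge3$, $\Gamma\ne0$, $\log p\le c_1n$ and $$\Delta(C^*)\ \ge\ c_2|\Gamma|_\infty\left\{\sqrt{\frac{\log p}{mn}}+\sqrt{\frac{p}{nm^2}}+\frac{\log p}{n}+\frac{p}{nm}\right\},$$ then, with probability at least $1-c_3/p$, $\widehat B_{adapt}=B^*$: whatever the choice of the minimizers $ne_1,ne_2$, the maximizer over $\mathcal C_0$ is unique and equal to $B^*$. -/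

import Mathlib

open MeasureTheory ProbabilityTheory
open scoped Matrix

noncomputable section

namespace VariableClustering

/-! ### Matrices and partitions -/

/-- The entrywise sup norm `|A|_∞`. -/
def supNorm {p q : ℕ} (A : Matrix (Fin p) (Fin q) ℝ) : ℝ := ⨆ a, ⨆ b, |A a b|

/-- The Frobenius scalar product `⟨A, B⟩`. -/
def frobInner {p q : ℕ} (A B : Matrix (Fin p) (Fin q) ℝ) : ℝ := ∑ a, ∑ b, A a b * B a b

/-- The Euclidean norm `|v|₂`. -/
def l2Norm {n : ℕ} (v : Fin n → ℝ) : ℝ := √(∑ i, v i ^ 2)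

/-- The size of the group `G_k = {a | g a = k}` of the partition encoded by the map `g`, which
sends every index to the label of its group. -/
def groupSize {p K : ℕ} (g : Fin p → Fin K) (k : Fin K) : ℕ :=
  (Finset.univ.filter fun a => g a = k).card

/-- The size `m` of the smallest group (it is `0` if there is no group or an empty one). -/
def minGroupSize {p K : ℕ} (g : Fin p → Fin K) : ℕ := ⨅ k, groupSize g k

/-- The normalized partnership matrix `B*` of the partition. -/
def partnership {p K : ℕ} (g : Fin p → Fin K) : Matrix (Fin p) (Fin p) ℝ :=
  Matrix.of fun a b => if g a = g b then 1 / (groupSize g (g a) : ℝ) else 0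

/-- The cluster separation `Δ(C) = min_{j < k} (C_kk + C_jj - 2 C_jk)`. It is `⊤`, the minimum of
the empty set, if there is only one group. -/
def separation {K : ℕ} (C : Matrix (Fin K) (Fin K) ℝ) : EReal :=
  ⨅ (j : Fin K) (k : Fin K) (_ : j < k), ((C k k + C j j - 2 * C j k : ℝ) : EReal)

/-! ### The model -/

/-- The covariance matrix `Cov(Y)` of a random vector `Y`. -/
def covMatrix {Ω : Type*} [MeasurableSpace Ω] (P : Measure Ω) {q : ℕ} (Y : Ω → Fin q → ℝ) :
    Matrix (Fin q) (Fin q) ℝ :=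
  Matrix.of fun a b => covariance (fun ω => Y ω a) (fun ω => Y ω b) P

/-- The Gaussian vector `X` has a latent decomposition with respect to the partition `g`, with
latent vector `Z` and error vector `E`. -/
structure IsGaussianLatentModel {Ω : Type*} [MeasurableSpace Ω] (P : Measure Ω) {p K : ℕ}
    (g : Fin p → Fin K) (X : Ω → Fin p → ℝ) (Z : Ω → Fin K → ℝ) (E : Ω → Fin p → ℝ) : Prop where
  /-- `X_a = Z_k + E_a` for all `a ∈ G_k`. -/
  decomposition : ∀ ω a, X ω a = Z ω (g a) + E ω a
  measurable_latent : Measurable Z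
  measurable_error : Measurable E
  memLp_latent : ∀ k, MemLp (fun ω => Z ω k) 2 P
  memLp_error : ∀ a, MemLp (fun ω => E ω a) 2 P
  mean_latent : ∀ k, ∫ ω, Z ω k ∂P = 0
  mean_error : ∀ a, ∫ ω, E ω a ∂P = 0
  /-- `Z` is independent of `E`. -/
  indep_latent_error : IndepFun Z E P
  /-- `E` has independent entries. -/
  indep_error : iIndepFun (fun a ω => E ω a) P
  /-- The error variances are equal within a group. -/
  variance_error : ∀ a b, g a = g b → Var[fun ω => E ω a; P] = Var[fun ω => E ω b; P]
  gaussian : HasGaussianLaw X P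

/-! ### The estimators, as functions of the `n × p` data matrix `X` -/

/-- The sample covariance matrix `Σ̂ = XᵗX / n`. -/
def sampleCov {n p : ℕ} (X : Matrix (Fin n) (Fin p) ℝ) : Matrix (Fin p) (Fin p) ℝ :=
  (1 / (n : ℝ)) • (Xᵀ * X)

/-- `V(a,b)`, the maximum over `c, d ∈ [p] \ {a, b}` of
`|⟨X_{:a} - X_{:b}, (X_{:c} - X_{:d}) / |X_{:c} - X_{:d}|₂⟩|`, with `0 / 0 = 0`. -/
def colDissim {n p : ℕ} (X : Matrix (Fin n) (Fin p) ℝ) (a b : Fin p) : ℝ :=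
  ⨆ cd : {c : Fin p // c ≠ a ∧ c ≠ b} × {d : Fin p // d ≠ a ∧ d ≠ b},
    |(X.col a - X.col b) ⬝ᵥ
      ((l2Norm (X.col cd.1 - X.col cd.2))⁻¹ • (X.col cd.1 - X.col cd.2))|

/-- `ne₁` and `ne₂` choose the two neighbors of every index: `ne₁ a` minimizes `V(a, ·)` over
`[p] \ {a}` and `ne₂ a` minimizes it over `[p] \ {a, ne₁ a}`. Ties may be broken in any way. -/
structure IsNeighborChoice {n p : ℕ} (X : Matrix (Fin n) (Fin p) ℝ) (ne₁ ne₂ : Fin p → Fin p) :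
    Prop where
  ne₁_mem : ∀ a, ne₁ a ≠ a
  ne₁_min : ∀ a b, b ≠ a → colDissim X a (ne₁ a) ≤ colDissim X a b
  ne₂_mem : ∀ a, ne₂ a ≠ a ∧ ne₂ a ≠ ne₁ a
  ne₂_min : ∀ a b, b ≠ a → b ≠ ne₁ a → colDissim X a (ne₂ a) ≤ colDissim X a b

/-- The diagonal matrix `Γ̂` with `Γ̂_aa = ⟨X_{:a} - X_{:ne₁(a)}, X_{:a} - X_{:ne₂(a)}⟩ / n`. -/
def gammaHat {n p : ℕ} (X : Matrix (Fin n) (Fin p) ℝ) (ne₁ ne₂ : Fin p → Fin p) :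
    Matrix (Fin p) (Fin p) ℝ :=
  Matrix.diagonal fun a =>
    (1 / (n : ℝ)) * ((X.col a - X.col (ne₁ a)) ⬝ᵥ (X.col a - X.col (ne₂ a)))

/-- `κ̂ = 5 |Γ̂|_∞ (√(p/n) + p/n)`. -/
def kappaHat (n : ℕ) {p : ℕ} (Γhat : Matrix (Fin p) (Fin p) ℝ) : ℝ :=
  5 * supNorm Γhat * (√((p : ℝ) / n) + (p : ℝ) / n)

/-- The convex domain `C₀`. -/
def domainC0 (p : ℕ) : Set (Matrix (Fin p) (Fin p) ℝ) :=
  {B | B.PosSemidef ∧ (∀ b, ∑ a, B a b = 1) ∧ ∀ a b, 0 ≤ B a b}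

/-- The set of all values that the estimator `B̂_adapt` can take on the data `X`, over all ways of
breaking the ties in the choice of the neighbors and all maximizers over `C₀` of
`⟨Σ̂ - Γ̂, B⟩ - κ̂ tr(B)`. -/
def adaptiveEstimators {n p : ℕ} (X : Matrix (Fin n) (Fin p) ℝ) :
    Set (Matrix (Fin p) (Fin p) ℝ) :=
  {Bhat | ∃ ne₁ ne₂ : Fin p → Fin p, IsNeighborChoice X ne₁ ne₂ ∧ Bhat ∈ domainC0 p ∧
    IsMaxOn (fun B => frobInner (sampleCov X - gammaHat X ne₁ ne₂) B
      - kappaHat n (gammaHat X ne₁ ne₂) * B.trace) (domainC0 p) Bhat}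

end VariableClustering

end

open MeasureTheory ProbabilityTheory
open scoped Matrix

noncomputable section

namespace VariableClustering

/-! ### Deviations of the chi-square distribution -/

/-! The data matrix has the law of `X_a = z_{g a} + σ_a ε_a`, where the `z_k` and `ε_a` are images
of fixed vectors under one standard Gaussian design. This reduces the theorem to a deterministic
statement on a good event, `IsRegularSample`: scalar products of latent differences and errors are
within a relative error `θ ≍ √(log p / n)` of their means, and the errors satisfy `|∑ x_a ε_a|² / n
≤ (1 + L)|x|²` with `L = 4.97 y`, `y = √(p/n) + p/n`.

Neighbors. If `a` and `b` share a group, `X_a - X_b` is pure noise, nearly orthogonal to every other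
column difference, so `V(a,b)` is small. Conversely, testing against `X_c - X_d` with `c`, `d` other
members of the groups of `a` and `b` shows that a small `V(a,b)` forces the squared latent distance
to be `O(θ S²)`, with `S² = |Γ|_∞`. Thus a neighbor may lie in a wrong group, but only in one so
close that `Γ̂_aa` is still within `100 θ S²` of `Γ_aa` (`abs_gammaHat_sub_le`).

Optimization. The difference between the objective at `B*` and at a competitor `B` is bounded below
by a weighted sum of the off-group entries of `B`, plus a multiple of the trace of `(1 - B*) B (1 -
B*)` (`penalizedObjective_sub_ge`). The weights are half the squared latent distance minus
fluctuations, positive by the separation hypothesis. The trace coefficient is `κ̂` minus a bound for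
the largest eigenvalue of the noise. Both being positive, a competitor doing as well as `B*` has no
off-group mass and no residual, hence equals `B*` (`eq_partnership`).

The delicate constant is the 5 in `κ̂`: the noise eigenvalue must be at most about `4.98 S² y`. The
usual net argument is too lossy, so `quadratic_le_of_net` exploits that a quadratic form varies only
to second order near a maximizer. The constant `c₃` is taken so large that only `p ≥ 10^21` matters;
there `log p` is negligible before `p`, so errors of order `θ` fit into the remaining margin. -/

lemma gaussianPDFReal_mul_exp_sq (s x : ℝ) :
    gaussianPDFReal 0 1 x * Real.exp (s * x ^ 2)
      = (√(2 * Real.pi))⁻¹ * Real.exp (-(1 / 2 - s) * x ^ 2) := by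
  simp only [gaussianPDFReal, NNReal.coe_one, mul_one, sub_zero]
  rw [mul_assoc, ← Real.exp_add]
  congr 2
  ring

lemma integral_exp_mul_sq_gaussianReal {s : ℝ} (hs : s < 1 / 2) :
    ∫ x, Real.exp (s * x ^ 2) ∂(gaussianReal 0 1) = (√(1 - 2 * s))⁻¹ := by
  rw [integral_gaussianReal_eq_integral_smul (by norm_num)]
  simp only [smul_eq_mul, gaussianPDFReal_mul_exp_sq]
  rw [integral_const_mul, integral_gaussian, ← Real.sqrt_inv, ← Real.sqrt_mul (by positivity),
    ← Real.sqrt_inv]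
  congr 1
  have : 1 / 2 - s ≠ 0 := by linarith
  have : 1 - 2 * s ≠ 0 := by linarith
  have := Real.pi_ne_zero
  field_simp

lemma integrable_exp_mul_sq_gaussianReal {s : ℝ} (hs : s < 1 / 2) :
    Integrable (fun x => Real.exp (s * x ^ 2)) (gaussianReal 0 1) := by
  -- The integral of a non-integrable function is 0 by default, whereas the computed value is
  -- positive.
  by_contra h
  have h1 := integral_exp_mul_sq_gaussianReal hs
  rw [integral_undef h] at h1
  have : 0 < (√(1 - 2 * s))⁻¹ := inv_pos.mpr (Real.sqrt_pos.mpr (by linarith))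
  linarith

/-- With `u = 1 / (1 - 2s) ≥ 1`, the inequality `x ≤ sinh x` at `x = log u` reads `log u ≤ (u - 1/u)
/ 2`, and the exponent on the right is exactly half of this bound. -/
lemma inv_sqrt_le_exp_of_nonneg {s : ℝ} (h0 : 0 ≤ s) (hs : s < 1 / 2) :
    (√(1 - 2 * s))⁻¹ ≤ Real.exp (s + s ^ 2 / (1 - 2 * s)) := by
  have hp : 0 < 1 - 2 * s := by linarith
  have hy : 1 ≤ (1 - 2 * s)⁻¹ := (one_le_inv₀ hp).mpr (by linarith)
  have h := Real.self_le_sinh_iff.mpr (Real.log_nonneg hy)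
  rw [Real.sinh_eq, Real.exp_neg, Real.exp_log (by positivity), inv_inv] at h
  rw [← Real.sqrt_inv, ← Real.exp_log (Real.sqrt_pos.mpr (inv_pos.mpr hp)),
    Real.log_sqrt (by positivity)]
  apply Real.exp_le_exp.mpr
  have : s + s ^ 2 / (1 - 2 * s) = ((1 - 2 * s)⁻¹ - (1 - 2 * s)) / 2 / 2 := by
    obtain ⟨d, hd⟩ : ∃ d, d = 1 - 2 * s := ⟨_, rfl⟩
    have hd0 : d ≠ 0 := hd ▸ hp.ne'
    rw [← hd, show s = (1 - d) / 2 by linarith]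
    field_simp
    ring
  rw [this]
  linarith

lemma inv_sqrt_le_exp_of_nonpos {r : ℝ} (h0 : 0 ≤ r) :
    (√(1 - 2 * -r))⁻¹ ≤ Real.exp (-r + r ^ 2) := by
  have hp : 0 < 1 - 2 * -r := by linarith
  rw [← Real.sqrt_inv, ← Real.exp_log (Real.sqrt_pos.mpr (inv_pos.mpr hp)),
    Real.log_sqrt (by positivity), Real.log_inv]
  apply Real.exp_le_exp.mpr
  have h := Real.le_log_one_add_of_nonneg (x := 2 * r) (by linarith)
  have h2 : 2 * r - (2 * r) ^ 2 / 2 ≤ 2 * (2 * r) / (2 * r + 2) := by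
    rw [le_div_iff₀ (by linarith)]
    nlinarith [pow_nonneg h0 3]
  have h3 : 1 - 2 * -r = 1 + 2 * r := by ring
  rw [h3]
  linarith

section ChiSquare

variable {Ω : Type*} [MeasurableSpace Ω] {μ : Measure Ω} [IsProbabilityMeasure μ] {n : ℕ}
  {h : Fin n → Ω → ℝ}

omit [IsProbabilityMeasure μ] in
lemma mgf_sq_of_gaussian {f : Ω → ℝ} (hf : Measurable f) (hl : μ.map f = gaussianReal 0 1) {s : ℝ}
    (hs : s < 1 / 2) : mgf (fun ω => f ω ^ 2) μ s = (√(1 - 2 * s))⁻¹ := by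
  rw [← integral_exp_mul_sq_gaussianReal hs, ← hl, integral_map hf.aemeasurable (by fun_prop), mgf]

lemma integrable_exp_mul_sum_sq (hm : ∀ i, Measurable (h i)) (hi : iIndepFun h μ)
    (hl : ∀ i, μ.map (h i) = gaussianReal 0 1) {s : ℝ} (hs : s < 1 / 2) :
    Integrable (fun ω => Real.exp (s * ∑ i, h i ω ^ 2)) μ := by
  have hi' : iIndepFun (fun i ω => h i ω ^ 2) μ :=
    hi.comp (fun _ x => x ^ 2) (fun _ => by fun_prop)
  have := hi'.integrable_exp_mul_sum (t := s) (fun i => by have := hm i; fun_prop)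
    (s := Finset.univ) (fun i _ => by
      have h1 := integrable_exp_mul_sq_gaussianReal hs
      rw [← hl i] at h1
      exact h1.comp_measurable (hm i))
  simpa using this

omit [IsProbabilityMeasure μ] in
lemma mgf_sum_sq (hm : ∀ i, Measurable (h i)) (hi : iIndepFun h μ)
    (hl : ∀ i, μ.map (h i) = gaussianReal 0 1) {s : ℝ} (hs : s < 1 / 2) :
    mgf (fun ω => ∑ i, h i ω ^ 2) μ s = (√(1 - 2 * s))⁻¹ ^ n := by
  have hi' : iIndepFun (fun i ω => h i ω ^ 2) μ :=
    hi.comp (fun _ x => x ^ 2) (fun _ => by fun_prop)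
  have := hi'.mgf_sum (t := s) (fun i => by have := hm i; fun_prop) Finset.univ
  have h2 : (fun ω => ∑ i, h i ω ^ 2) = ∑ i, fun ω => h i ω ^ 2 := by
    ext ω; simp
  rw [h2, this, Finset.prod_congr rfl (fun i _ => mgf_sq_of_gaussian (hm i) (hl i) hs)]
  simp

lemma measureReal_sum_sq_ge (hn : 0 < n) (hm : ∀ i, Measurable (h i)) (hi : iIndepFun h μ)
    (hl : ∀ i, μ.map (h i) = gaussianReal 0 1) {t : ℝ} (ht : 0 ≤ t) :
    μ.real {ω | n + (2 * √(n * t) + 2 * t) ≤ ∑ i, h i ω ^ 2} ≤ Real.exp (-t) := by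
  have hN : (0 : ℝ) < n := by exact_mod_cast hn
  obtain ⟨a, ha, han⟩ : ∃ a : ℝ, 0 < a ∧ a ^ 2 = n := ⟨√n, Real.sqrt_pos.mpr hN, Real.sq_sqrt hN.le⟩
  obtain ⟨b, hb, hbt⟩ : ∃ b : ℝ, 0 ≤ b ∧ b ^ 2 = t := ⟨√t, Real.sqrt_nonneg _, Real.sq_sqrt ht⟩
  have hab : √(n * t) = a * b := by
    rw [← han, ← hbt, ← mul_pow, Real.sqrt_sq (by positivity)]
  -- This is the minimizer of the Chernoff exponent, with `a = √n` and `b = √t`; the exponent is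
  -- then exactly `-t`.
  set s := b / (a + 2 * b) with hsdef
  have hd : 0 < a + 2 * b := by linarith
  have hs0 : 0 ≤ s := by positivity
  have hs1 : 1 - 2 * s = a / (a + 2 * b) := by rw [hsdef]; field_simp; ring
  have hs : s < 1 / 2 := by
    have : 0 < a / (a + 2 * b) := by positivity
    linarith
  refine (measure_ge_le_exp_mul_mgf _ hs0 (integrable_exp_mul_sum_sq hm hi hl hs)).trans ?_
  rw [mgf_sum_sq hm hi hl hs]
  calc _ ≤ Real.exp (-s * (n + (2 * √(n * t) + 2 * t)))
        * Real.exp (s + s ^ 2 / (1 - 2 * s)) ^ n := by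
        gcongr
        exact inv_sqrt_le_exp_of_nonneg hs0 hs
    _ = Real.exp (-t) := by
        rw [← Real.exp_nat_mul, ← Real.exp_add, hs1, hab, ← han, ← hbt, hsdef]
        congr 1
        field_simp
        ring

lemma measureReal_sum_sq_le (hn : 0 < n) (hm : ∀ i, Measurable (h i)) (hi : iIndepFun h μ)
    (hl : ∀ i, μ.map (h i) = gaussianReal 0 1) {t : ℝ} (ht : 0 ≤ t) :
    μ.real {ω | ∑ i, h i ω ^ 2 ≤ n - 2 * √(n * t)} ≤ Real.exp (-t) := by
  have hN : (0 : ℝ) < n := by exact_mod_cast hn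
  obtain ⟨a, ha, han⟩ : ∃ a : ℝ, 0 < a ∧ a ^ 2 = n := ⟨√n, Real.sqrt_pos.mpr hN, Real.sq_sqrt hN.le⟩
  obtain ⟨b, hb, hbt⟩ : ∃ b : ℝ, 0 ≤ b ∧ b ^ 2 = t := ⟨√t, Real.sqrt_nonneg _, Real.sq_sqrt ht⟩
  have hab : √(n * t) = a * b := by
    rw [← han, ← hbt, ← mul_pow, Real.sqrt_sq (by positivity)]
  have hr : 0 ≤ b / a := by positivity
  -- The Chernoff parameter is `-√(t/n)`, which makes the exponent `-2t + t`.
  have hs : -(b / a) < 1 / 2 := by linarith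
  refine (measure_le_le_exp_mul_mgf _ (by linarith : -(b / a) ≤ 0)
    (integrable_exp_mul_sum_sq hm hi hl hs)).trans ?_
  rw [mgf_sum_sq hm hi hl hs]
  calc _ ≤ Real.exp (-(-(b / a)) * (n - 2 * √(n * t)))
        * Real.exp (-(b / a) + (b / a) ^ 2) ^ n := by
        gcongr
        exact inv_sqrt_le_exp_of_nonpos hr
    _ = Real.exp (-t) := by
        rw [← Real.exp_nat_mul, ← Real.exp_add, hab, ← han, ← hbt]
        congr 1
        field_simp
        ring

/-- The two-sided deviation inequality for a chi-square variable. -/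
lemma measureReal_abs_sum_sq_sub_ge (hn : 0 < n) (hm : ∀ i, Measurable (h i)) (hi : iIndepFun h μ)
    (hl : ∀ i, μ.map (h i) = gaussianReal 0 1) {t : ℝ} (ht : 0 ≤ t) :
    μ.real {ω | 2 * √(n * t) + 2 * t ≤ |∑ i, h i ω ^ 2 - n|} ≤ 2 * Real.exp (-t) := by
  have hsub : {ω | 2 * √(n * t) + 2 * t ≤ |∑ i, h i ω ^ 2 - n|}
      ⊆ {ω | n + (2 * √(n * t) + 2 * t) ≤ ∑ i, h i ω ^ 2}
        ∪ {ω | ∑ i, h i ω ^ 2 ≤ n - 2 * √(n * t)} := by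
    intro ω hω
    have hω' : 2 * √(n * t) + 2 * t ≤ |∑ i, h i ω ^ 2 - n| := hω
    rcases le_abs.mp hω' with h1 | h1
    · left; rw [Set.mem_ofPred_eq]; linarith
    · right; rw [Set.mem_ofPred_eq]; linarith
  calc _ ≤ _ := measureReal_mono hsub
    _ ≤ _ := measureReal_union_le _ _
    _ ≤ _ := add_le_add (measureReal_sum_sq_ge hn hm hi hl ht) (measureReal_sum_sq_le hn hm hi hl ht)
    _ = _ := by ring

end ChiSquare

/-! ### Nets of the unit sphere and quadratic forms -/

section Net

open Metric Module
open scoped ENNReal NNReal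

variable {E : Type*} [NormedAddCommGroup E] [NormedSpace ℝ E] [FiniteDimensional ℝ E]

/-- Volume comparison: the balls of radius `r/2` around the points are disjoint and contained in the
ball of radius `1 + r/2`. -/
lemma card_le_of_separated_sphere {r : ℝ} (hr : 0 < r) (s : Finset E) (hs : ∀ c ∈ s, ‖c‖ ≤ 1)
    (h : ∀ c ∈ s, ∀ d ∈ s, c ≠ d → r ≤ ‖c - d‖) :
    (s.card : ℝ) ≤ (1 + 2 / r) ^ finrank ℝ E := by
  borelize E
  let μ : Measure E := Measure.addHaar
  have hδ : 0 < r / 2 := by positivity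
  have hρ : 0 < 1 + r / 2 := by positivity
  have D : Set.Pairwise (s : Set E) (Function.onFun Disjoint fun c => ball (c : E) (r / 2)) := by
    rintro c hc d hd hcd
    apply ball_disjoint_ball
    rw [dist_eq_norm]
    linarith [h c hc d hd hcd]
  have hsub : (⋃ c ∈ s, ball (c : E) (r / 2)) ⊆ ball (0 : E) (1 + r / 2) := by
    refine Set.iUnion₂_subset fun x hx => ball_subset_ball' ?_
    rw [dist_zero_right]
    linarith [hs x hx]
  have I : (s.card : ℝ≥0∞) * ENNReal.ofReal ((r / 2) ^ finrank ℝ E) * μ (ball 0 1) ≤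
      ENNReal.ofReal ((1 + r / 2) ^ finrank ℝ E) * μ (ball 0 1) :=
    calc
      _ = μ (⋃ c ∈ s, ball (c : E) (r / 2)) := by
        rw [measure_biUnion_finset D fun c _ => measurableSet_ball]
        simp only [μ.addHaar_ball_of_pos _ hδ]
        simp only [Finset.sum_const, nsmul_eq_mul, mul_assoc]
      _ ≤ μ (ball (0 : E) (1 + r / 2)) := measure_mono hsub
      _ = _ := by simp only [μ.addHaar_ball_of_pos _ hρ]
  have J := (ENNReal.mul_le_mul_iff_left (measure_ball_pos μ 0 zero_lt_one).ne'
    measure_ball_lt_top.ne).1 I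
  have K := ENNReal.toReal_le_of_le_ofReal (pow_nonneg hρ.le _) J
  rw [ENNReal.toReal_mul, ENNReal.toReal_natCast, ENNReal.toReal_ofReal (by positivity),
    ← le_div_iff₀ (by positivity), ← div_pow] at K
  have hbase : 1 + 2 / r = (1 + r / 2) / (r / 2) := by
    field_simp
    ring
  rwa [hbase]

/-- The unit sphere of a space of dimension `d` has an `r`-net with at most `(1 + 2 / r) ^ d`
points. -/
lemma exists_net_sphere {r : ℝ} (hr : 0 < r) :
    ∃ s : Finset E, (s.card : ℝ) ≤ (1 + 2 / r) ^ finrank ℝ E ∧ (∀ y ∈ s, ‖y‖ = 1) ∧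
      ∀ x : E, ‖x‖ = 1 → ∃ y ∈ s, ‖x - y‖ ≤ r := by
  classical
  let S : Set ℕ := {k | ∃ s : Finset E, s.card = k ∧ (∀ c ∈ s, ‖c‖ = 1) ∧
    ∀ c ∈ s, ∀ d ∈ s, c ≠ d → r ≤ ‖c - d‖}
  have hS : S.Nonempty := ⟨0, ∅, by simp⟩
  have hB : BddAbove S := by
    refine ⟨⌈(1 + 2 / r) ^ finrank ℝ E⌉₊, ?_⟩
    rintro k ⟨s, rfl, h1, h2⟩
    have := card_le_of_separated_sphere hr s (fun c hc => (h1 c hc).le) h2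
    exact_mod_cast this.trans (Nat.le_ceil _)
  -- An `r`-separated subset of the sphere of maximal size is an `r`-net: a point at distance more
  -- than `r` from it could be added.
  obtain ⟨s, hk, h1, h2⟩ := Nat.sSup_mem hS hB
  refine ⟨s, card_le_of_separated_sphere hr s (fun c hc => (h1 c hc).le) h2, h1, fun x hx => ?_⟩
  by_contra! hcon
  have hxs : x ∉ s := fun hmem => by
    have := hcon x hmem
    simp at this
    linarith
  have hmem : s.card + 1 ∈ S := by
    refine ⟨insert x s, Finset.card_insert_of_notMem hxs, ?_, ?_⟩
    · intro c hc
      rcases Finset.mem_insert.mp hc with rfl | hc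
      exacts [hx, h1 c hc]
    · intro c hc d hd hcd
      rcases Finset.mem_insert.mp hc with rfl | hc' <;>
        rcases Finset.mem_insert.mp hd with rfl | hd'
      · exact absurd rfl hcd
      · exact (hcon d hd').le
      · rw [norm_sub_rev]; exact (hcon c hc').le
      · exact h2 c hc' d hd' hcd
  have := le_csSup hB hmem
  omega

end Net

/-! ### Quadratic forms controlled on a net -/

section QuadraticForm

variable {E : Type*} [NormedAddCommGroup E] [InnerProductSpace ℝ E] [FiniteDimensional ℝ E]

open scoped InnerProductSpace

omit [FiniteDimensional ℝ E] in
/-- If `ν` is the largest value of `|⟪T x, x⟫|` on the sphere and it is attained at `x`, then it is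
almost attained near `x`. -/
lemma quadratic_ge_of_isMax {T : E →ₗ[ℝ] E} (hT : T.IsSymmetric) {ν : ℝ}
    (hν : ∀ y, |⟪T y, y⟫_ℝ| ≤ ν * ‖y‖ ^ 2) {x y : E} (hx : ‖x‖ = 1) (hy : ‖y‖ = 1)
    (hxν : ⟪T x, x⟫_ℝ = ν) : ν * (2 * ⟪x, y⟫_ℝ ^ 2 - 1) ≤ ⟪T y, y⟫_ℝ := by
  -- `x` is an eigenvector
  have hsym : ∀ u v, ⟪T u, v⟫_ℝ = ⟪T v, u⟫_ℝ := fun u v => by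
    rw [hT u v, real_inner_comm]
  have hxx : ⟪x, x⟫_ℝ = 1 := by rw [real_inner_self_eq_norm_sq, hx]; norm_num
  have hyy : ⟪y, y⟫_ℝ = 1 := by rw [real_inner_self_eq_norm_sq, hy]; norm_num
  have heig : ∀ w, ⟪T x, w⟫_ℝ = ν * ⟪x, w⟫_ℝ := by
    intro w
    -- The form `ν‖·‖² - ⟪T ·, ·⟫` is nonnegative and vanishes at `x`. Along `x + t w` it is a
    -- polynomial in `t` without constant term, so its discriminant forces the linear coefficient to
    -- vanish.
    have key : ∀ t : ℝ, 0 ≤ (ν * ⟪w, w⟫_ℝ - ⟪T w, w⟫_ℝ) * (t * t)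
        + (2 * (ν * ⟪x, w⟫_ℝ - ⟪T x, w⟫_ℝ)) * t + 0 := by
      intro t
      have h1 := (le_abs_self _).trans (hν (x + t • w))
      rw [← real_inner_self_eq_norm_sq] at h1
      simp only [map_add, map_smul, inner_add_left, inner_add_right, inner_smul_left,
        inner_smul_right, RCLike.conj_to_real] at h1
      rw [hsym w x, real_inner_comm x w, hxν, hxx] at h1
      nlinarith
    have := discrim_le_zero key
    rw [discrim] at this
    have h0 : (2 * (ν * ⟪x, w⟫_ℝ - ⟪T x, w⟫_ℝ)) ^ 2 = 0 := le_antisymm (by linarith) (sq_nonneg _)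
    have := pow_eq_zero_iff (two_ne_zero) |>.mp h0
    linarith
  set c := ⟪x, y⟫_ℝ with hc
  -- The component of `y` orthogonal to the eigenvector `x` contributes at least `-ν (1 - c²)`, the
  -- component along `x` contributes `ν c²`, and there is no cross term.
  have h2 := (neg_le_of_abs_le (hν (y - c • x)))
  rw [← real_inner_self_eq_norm_sq] at h2
  simp only [map_sub, map_smul, inner_sub_left, inner_sub_right, inner_smul_left,
    inner_smul_right, RCLike.conj_to_real] at h2
  rw [hsym y x, heig y, heig x, real_inner_comm x y, hxx, hyy, ← hc] at h2
  nlinarith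

/-- A bound of a quadratic form on a `3/10`-net of the sphere gives a bound everywhere. -/
lemma quadratic_le_of_net {T : E →ₗ[ℝ] E} (hT : T.IsSymmetric) {s : Finset E}
    (hs1 : ∀ y ∈ s, ‖y‖ = 1) (hs : ∀ x : E, ‖x‖ = 1 → ∃ y ∈ s, ‖x - y‖ ≤ 3 / 10) {τ : ℝ}
    (hτ : ∀ y ∈ s, |⟪T y, y⟫_ℝ| ≤ τ) (x : E) : |⟪T x, x⟫_ℝ| ≤ τ / (103 / 125) * ‖x‖ ^ 2 := by
  rcases eq_or_ne x 0 with rfl | hx0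
  · simp
  have : Nontrivial E := ⟨x, 0, hx0⟩
  have hcont : Continuous fun y : E => |⟪T y, y⟫_ℝ| := by
    have := T.continuous_of_finiteDimensional
    fun_prop
  obtain ⟨x₀, hx₀, hmax⟩ := (isCompact_sphere (0 : E) 1).exists_isMaxOn
    (NormedSpace.sphere_nonempty.mpr zero_le_one) hcont.continuousOn
  have hx₀ : ‖x₀‖ = 1 := by simpa using hx₀
  set ν := |⟪T x₀, x₀⟫_ℝ| with hν
  have hall : ∀ y, |⟪T y, y⟫_ℝ| ≤ ν * ‖y‖ ^ 2 := by
    intro y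
    rcases eq_or_ne y 0 with rfl | hy
    · simp
    have hyn : 0 < ‖y‖ := norm_pos_iff.mpr hy
    have h1 : |⟪T (‖y‖⁻¹ • y), ‖y‖⁻¹ • y⟫_ℝ| ≤ ν := hmax (by simp [norm_smul, hyn.ne'])
    simp only [map_smul, inner_smul_left, inner_smul_right, RCLike.conj_to_real, abs_mul,
      abs_inv, abs_norm] at h1
    have h2 := mul_le_mul_of_nonneg_right h1 (sq_nonneg ‖y‖)
    have h3 : ‖y‖⁻¹ * (‖y‖⁻¹ * |⟪T y, y⟫_ℝ|) * ‖y‖ ^ 2 = |⟪T y, y⟫_ℝ| := by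
      have := hyn.ne'
      field_simp
    linarith
  have hν0 : 0 ≤ ν := abs_nonneg _
  obtain ⟨y, hys, hxy⟩ := hs x₀ hx₀
  have hy1 := hs1 y hys
  have hin : (1 - (3 / 10) ^ 2 / 2 : ℝ) ≤ ⟪x₀, y⟫_ℝ := by
    have h1 := norm_sub_sq_real x₀ y
    rw [hx₀, hy1] at h1
    have h2 : ‖x₀ - y‖ ^ 2 ≤ (3 / 10) ^ 2 := by gcongr
    linarith
  -- `2 (1 - 0.045)² - 1 = 0.82405`, just above `103/125 = 0.824`.
  have hc : (103 / 125 : ℝ) ≤ 2 * ⟪x₀, y⟫_ℝ ^ 2 - 1 := by nlinarith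
  have hντ : ν * (103 / 125) ≤ τ := by
    have hT2 : (-T).IsSymmetric := by intro u v; simp [hT u v]
    have h3 : ν * (2 * ⟪x₀, y⟫_ℝ ^ 2 - 1) ≤ |⟪T y, y⟫_ℝ| := by
      rcases abs_cases ⟪T x₀, x₀⟫_ℝ with ⟨h, -⟩ | ⟨h, -⟩
      · exact (quadratic_ge_of_isMax hT hall hx₀ hy1 (by rw [hν, h])).trans (le_abs_self _)
      · have h4 := quadratic_ge_of_isMax hT2 (ν := ν) (by simpa using hall) hx₀ hy1
          (by simp [hν, h])
        refine h4.trans ?_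
        simpa using neg_le_abs ⟪T y, y⟫_ℝ
    have := hτ y hys
    nlinarith
  refine (hall x).trans ?_
  gcongr
  rw [le_div_iff₀ (by norm_num)]
  exact hντ

end QuadraticForm

/-! ### The partnership matrix and the domain `C₀` -/

section Partnership

variable {p K : ℕ} {g : Fin p → Fin K}

lemma groupSize_pos_of_index (g : Fin p → Fin K) (a : Fin p) : 0 < groupSize g (g a) :=
  Finset.card_pos.mpr ⟨a, by simp⟩

lemma partnership_apply (a b : Fin p) :
    partnership g a b = if g a = g b then 1 / (groupSize g (g a) : ℝ) else 0 := rfl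

lemma partnership_comm (a b : Fin p) : partnership g a b = partnership g b a := by
  rw [partnership_apply, partnership_apply]
  by_cases h : g a = g b
  · simp [h]
  · simp [h, Ne.symm h]

lemma partnership_transpose : (partnership g)ᵀ = partnership g := by
  ext a b
  exact partnership_comm b a

lemma partnership_nonneg (a b : Fin p) : 0 ≤ partnership g a b := by
  rw [partnership_apply]
  split_ifs <;> positivity

/-- Column `b` of `B*` is the uniform distribution on the group of `b`, so averaging against it
fixes every function of the label. The unit column sums and the idempotence of `B*` are special
cases. -/
lemma sum_partnership_mul (f : Fin K → ℝ) (b : Fin p) :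
    ∑ a, partnership g a b * f (g a) = f (g b) := by
  have h : ∀ a, partnership g a b * f (g a)
      = if g a = g b then (1 / (groupSize g (g b) : ℝ)) * f (g b) else 0 := by
    intro a
    rw [partnership_apply]
    split_ifs with h
    · rw [h]
    · simp
  have hpos : (groupSize g (g b) : ℝ) ≠ 0 := by exact_mod_cast (groupSize_pos_of_index g b).ne'
  rw [Finset.sum_congr rfl (fun a _ => h a), ← Finset.sum_filter, Finset.sum_const, nsmul_eq_mul]
  change (groupSize g (g b) : ℝ) * _ = _
  field_simp

lemma sum_partnership (b : Fin p) : ∑ a, partnership g a b = 1 := by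
  simpa using sum_partnership_mul (g := g) (fun _ => 1) b

lemma partnership_mul_self : partnership g * partnership g = partnership g := by
  ext a b
  rw [Matrix.mul_apply]
  have h : ∀ c, partnership g a c * partnership g c b
      = partnership g c b * (fun k => if g a = k then 1 / (groupSize g (g a) : ℝ) else 0) (g c) := by
    intro c
    rw [mul_comm, partnership_apply a c]
  rw [Finset.sum_congr rfl (fun c _ => h c)]
  exact sum_partnership_mul (g := g)
    (fun k => if g a = k then 1 / (groupSize g (g a) : ℝ) else 0) b

lemma partnership_posSemidef : (partnership g).PosSemidef := by
  have h := Matrix.posSemidef_conjTranspose_mul_self (partnership g)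
  rwa [Matrix.conjTranspose_eq_transpose_of_trivial, partnership_transpose,
    partnership_mul_self] at h

lemma partnership_mem_domainC0 : partnership g ∈ domainC0 p :=
  ⟨partnership_posSemidef, sum_partnership, partnership_nonneg⟩

lemma domainC0_comm {B : Matrix (Fin p) (Fin p) ℝ} (hB : B ∈ domainC0 p) (a b : Fin p) :
    B a b = B b a := by
  have h := hB.1.1.apply b a
  simpa using h

lemma domainC0_transpose {B : Matrix (Fin p) (Fin p) ℝ} (hB : B ∈ domainC0 p) : Bᵀ = B := by
  ext a b
  exact domainC0_comm hB b a

/-- The mass that `B` puts on pairs of indices from different groups. -/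
def offMass (g : Fin p → Fin K) (B : Matrix (Fin p) (Fin p) ℝ) : ℝ :=
  ∑ a, ∑ b, B a b * (if g a = g b then 0 else 1)

/-- A matrix whose rows are constant on groups is integrated against `B* - B` through the
off-diagonal blocks of `B` only. -/
lemma frobInner_partnership_sub {B : Matrix (Fin p) (Fin p) ℝ} (hB : B ∈ domainC0 p)
    (U : Matrix (Fin p) (Fin p) ℝ) (f : Fin K → Fin p → ℝ) (hf : ∀ a b, U a b = f (g a) b) :
    frobInner U (partnership g - B) = -∑ a, ∑ b, B a b * (f (g a) b - f (g b) b) := by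
  rw [frobInner, Finset.sum_comm]
  rw [Finset.sum_comm (f := fun a b => B a b * (f (g a) b - f (g b) b)), ← Finset.sum_neg_distrib]
  refine Finset.sum_congr rfl fun b _ => ?_
  have h1 := sum_partnership_mul (g := g) (fun k => f k b) b
  have h2 := hB.2.1 b
  calc ∑ a, U a b * (partnership g - B) a b
      = ∑ a, partnership g a b * f (g a) b - ∑ a, B a b * f (g a) b := by
        rw [← Finset.sum_sub_distrib]
        refine Finset.sum_congr rfl fun a _ => ?_
        rw [hf, Matrix.sub_apply]
        ring
    _ = (∑ a, B a b) * f (g b) b - ∑ a, B a b * f (g a) b := by rw [h1, h2, one_mul]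
    _ = _ := by
        rw [Finset.sum_mul, ← Finset.sum_sub_distrib, ← Finset.sum_neg_distrib]
        exact Finset.sum_congr rfl fun a _ => by ring

/-- By `frobInner_partnership_sub` only pairs from different groups contribute, each through a
difference of two entries of `U`, which costs `2ω`. -/
lemma abs_frobInner_partnership_sub_le {B : Matrix (Fin p) (Fin p) ℝ} (hB : B ∈ domainC0 p)
    (U : Matrix (Fin p) (Fin p) ℝ) (hU : ∀ a a' b, g a = g a' → U a b = U a' b) {ω : ℝ}
    (hω : ∀ a b, |U a b| ≤ ω) :
    |frobInner U (partnership g - B)| ≤ 2 * ω * offMass g B := by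
  classical
  -- Rows of `U` depend only on the label; the default 0 concerns labels that no index carries.
  let f : Fin K → Fin p → ℝ := fun k b => if h : ∃ a, g a = k then U h.choose b else 0
  have hf : ∀ a b, U a b = f (g a) b := by
    intro a b
    have h : ∃ a', g a' = g a := ⟨a, rfl⟩
    simp only [f, dif_pos h]
    exact hU _ _ _ h.choose_spec.symm
  rw [frobInner_partnership_sub hB U f hf, abs_neg, offMass, Finset.mul_sum]
  refine (Finset.abs_sum_le_sum_abs _ _).trans (Finset.sum_le_sum fun a _ => ?_)
  rw [Finset.mul_sum]
  refine (Finset.abs_sum_le_sum_abs _ _).trans (Finset.sum_le_sum fun b _ => ?_)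
  rw [abs_mul, abs_of_nonneg (hB.2.2 a b), ← hf, ← hf]
  split_ifs with h
  · simp [hU a b b h]
  · have h1 : |U a b - U b b| ≤ 2 * ω :=
      (abs_sub _ _).trans (by linarith [hω a b, hω b b])
    have := mul_le_mul_of_nonneg_left h1 (hB.2.2 a b)
    linarith

lemma partnership_mul_congr (W : Matrix (Fin p) (Fin p) ℝ) {a a' : Fin p} (b : Fin p)
    (h : g a = g a') : (partnership g * W) a b = (partnership g * W) a' b := by
  rw [Matrix.mul_apply, Matrix.mul_apply]
  refine Finset.sum_congr rfl fun c _ => ?_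
  rw [partnership_apply, partnership_apply, h]

lemma abs_mul_partnership_le {U : Matrix (Fin p) (Fin p) ℝ} {ω : ℝ} (hω : ∀ a b, |U a b| ≤ ω)
    (a b : Fin p) : |(U * partnership g) a b| ≤ ω := by
  rw [Matrix.mul_apply]
  calc _ ≤ ∑ c, |U a c * partnership g c b| := Finset.abs_sum_le_sum_abs _ _
    _ ≤ ∑ c, ω * partnership g c b := Finset.sum_le_sum fun c _ => by
        rw [abs_mul, abs_of_nonneg (partnership_nonneg c b)]
        exact mul_le_mul_of_nonneg_right (hω a c) (partnership_nonneg c b)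
    _ = ω := by rw [← Finset.mul_sum, sum_partnership, mul_one]

/-! ### The Frobenius scalar product -/

lemma frobInner_eq_trace (A B : Matrix (Fin p) (Fin p) ℝ) : frobInner A B = (Aᵀ * B).trace := by
  rw [frobInner, Matrix.trace, Finset.sum_comm]
  simp [Matrix.mul_apply]

lemma frobInner_add_left (A A' B : Matrix (Fin p) (Fin p) ℝ) :
    frobInner (A + A') B = frobInner A B + frobInner A' B := by
  simp only [frobInner, Matrix.add_apply, add_mul, Finset.sum_add_distrib]

lemma frobInner_sub_right (A B B' : Matrix (Fin p) (Fin p) ℝ) :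
    frobInner A (B - B') = frobInner A B - frobInner A B' := by
  simp only [frobInner, Matrix.sub_apply, mul_sub, Finset.sum_sub_distrib]

lemma _root_.Matrix.PosSemidef.exists_gram {ι : Type*} [Finite ι] {M : Matrix ι ι ℝ}
    (hM : M.PosSemidef) :
    ∃ (m : ℕ) (v : Fin m → ι → ℝ), ∀ a b, M a b = ∑ i, v i a * v i b := by
  obtain ⟨m, v, hv⟩ := Matrix.posSemidef_iff_eq_sum_vecMulVec.mp hM
  refine ⟨m, v, fun a b => ?_⟩
  rw [hv, Matrix.sum_apply]
  simp [Matrix.vecMulVec_apply]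

/-- A positive semidefinite `M` is a sum of rank-one matrices `v vᵗ`, and on each of them the claim
is the bound on the quadratic form at `v`. -/
lemma frobInner_le_mul_trace {W M : Matrix (Fin p) (Fin p) ℝ} {l : ℝ}
    (hW : ∀ x : Fin p → ℝ, x ⬝ᵥ W *ᵥ x ≤ l * (x ⬝ᵥ x)) (hM : M.PosSemidef) :
    frobInner W M ≤ l * M.trace := by
  obtain ⟨m, V, hV⟩ := hM.exists_gram
  have h1 : frobInner W M = ∑ i, V i ⬝ᵥ W *ᵥ V i := by
    simp only [frobInner, hV, dotProduct, Matrix.mulVec, Finset.mul_sum]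
    rw [Finset.sum_comm]
    refine (Finset.sum_congr rfl fun a _ => Finset.sum_comm).trans ?_
    rw [Finset.sum_comm]
    refine Finset.sum_congr rfl fun i _ => ?_
    rw [Finset.sum_comm]
    exact Finset.sum_congr rfl fun a _ => Finset.sum_congr rfl fun b _ => by ring
  have h2 : M.trace = ∑ i, V i ⬝ᵥ V i := by
    simp only [Matrix.trace, Matrix.diag_apply, hV, dotProduct]
    rw [Finset.sum_comm]
  rw [h1, h2, Finset.mul_sum]
  exact Finset.sum_le_sum fun i _ => hW (V i)

/-! ### The residual `(1 - B*) B (1 - B*)` -/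

/-- The compression of `B` to the orthogonal complement of the range of `B*`. -/
def residual (g : Fin p → Fin K) (B : Matrix (Fin p) (Fin p) ℝ) : Matrix (Fin p) (Fin p) ℝ :=
  (1 - partnership g) * B * (1 - partnership g)

lemma one_sub_partnership_transpose : (1 - partnership g)ᵀ = 1 - partnership g := by
  rw [Matrix.transpose_sub, Matrix.transpose_one, partnership_transpose]

lemma residual_posSemidef {B : Matrix (Fin p) (Fin p) ℝ} (hB : B.PosSemidef) :
    (residual g B).PosSemidef := by
  have h := hB.conjTranspose_mul_mul_same (1 - partnership g)
  rwa [Matrix.conjTranspose_eq_transpose_of_trivial, one_sub_partnership_transpose] at h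

/-- As `1 - B*` is a projection, the trace is `tr B - tr (B* B)`. This converts the trace penalty
into a reward for a small residual, up to a term controlled by the off-group mass. -/
lemma trace_residual (B : Matrix (Fin p) (Fin p) ℝ) :
    (residual g B).trace = B.trace - (partnership g).trace
      + frobInner (partnership g) (partnership g - B) := by
  rw [residual, Matrix.trace_mul_comm, ← Matrix.mul_assoc]
  have h : (1 - partnership g) * (1 - partnership g) = 1 - partnership g := by
    rw [mul_sub, sub_mul, sub_mul, partnership_mul_self]
    simp
  rw [h, frobInner_eq_trace, partnership_transpose, mul_sub, partnership_mul_self, sub_mul]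
  simp only [Matrix.trace_sub, Matrix.one_mul]
  ring

lemma frobInner_partnership_eq {B : Matrix (Fin p) (Fin p) ℝ} (hB : B ∈ domainC0 p) :
    frobInner (partnership g) (partnership g - B)
      = ∑ a, ∑ b, B a b * (if g a = g b then 0 else 1 / (groupSize g (g b) : ℝ)) := by
  rw [frobInner_partnership_sub hB (partnership g)
    (fun k b => if k = g b then 1 / (groupSize g k : ℝ) else 0) (fun a b => rfl),
    ← Finset.sum_neg_distrib]
  refine Finset.sum_congr rfl fun a _ => ?_
  rw [← Finset.sum_neg_distrib]
  refine Finset.sum_congr rfl fun b _ => ?_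
  rw [if_pos (rfl : g b = g b)]
  split_ifs with h <;> simp [h]

lemma frobInner_partnership_le {B : Matrix (Fin p) (Fin p) ℝ} (hB : B ∈ domainC0 p) {m : ℝ}
    (hm : 0 < m) (hmg : ∀ k, m ≤ groupSize g k) :
    frobInner (partnership g) (partnership g - B) ≤ offMass g B / m := by
  rw [frobInner_partnership_eq hB, offMass, Finset.sum_div]
  refine Finset.sum_le_sum fun a _ => ?_
  rw [Finset.sum_div]
  refine Finset.sum_le_sum fun b _ => ?_
  rw [mul_div_assoc]
  refine mul_le_mul_of_nonneg_left ?_ (hB.2.2 a b)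
  split_ifs with h
  · simp
  · exact one_div_le_one_div_of_le hm (hmg _)

/-- The noise term: `W` is controlled by the entries of `B* W` and by its largest eigenvalue. -/
lemma frobInner_noise_ge {B W : Matrix (Fin p) (Fin p) ℝ} (hB : B ∈ domainC0 p) (hWt : Wᵀ = W)
    {ω l : ℝ} (hω : ∀ a b, |(partnership g * W) a b| ≤ ω)
    (hW : ∀ x : Fin p → ℝ, x ⬝ᵥ W *ᵥ x ≤ l * (x ⬝ᵥ x)) :
    -(6 * ω * offMass g B) - l * (residual g B).trace ≤ frobInner W (partnership g - B) := by
  set P := partnership g with hP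
  have hPP : P * P = P := partnership_mul_self
  have hPt : Pᵀ = P := partnership_transpose
  -- Block decomposition of `P - B` along `P` and `1 - P`; the last block is `-(1 - P) B (1 - P)`
  -- because `(1 - P) P = 0`. The first three blocks see `W` only through `P W`, each at a cost of
  -- `2ω` times the off-group mass.
  have hR : P * (P - B) + (P - B) * P - P * (P - B) * P - residual g B = P - B := by
    rw [residual, ← hP]
    simp only [mul_sub, sub_mul, mul_one, one_mul, hPP]
    abel
  have h1 : frobInner W (P * (P - B)) = frobInner (P * W) (P - B) := by
    rw [frobInner_eq_trace, frobInner_eq_trace, Matrix.transpose_mul, hWt, hPt, Matrix.mul_assoc]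
  have hRt : (P - B)ᵀ = P - B := by rw [Matrix.transpose_sub, hPt, domainC0_transpose hB]
  have h2 : frobInner W ((P - B) * P) = frobInner (P * W) (P - B) := by
    rw [frobInner_eq_trace, frobInner_eq_trace, ← Matrix.trace_transpose, Matrix.transpose_mul,
      Matrix.transpose_mul, Matrix.transpose_mul, Matrix.transpose_transpose, hRt, hPt, hWt,
      Matrix.trace_mul_comm, Matrix.mul_assoc]
  have h3 : frobInner W (P * (P - B) * P) = frobInner (P * (W * P)) (P - B) := by
    rw [frobInner_eq_trace, frobInner_eq_trace, Matrix.transpose_mul, Matrix.transpose_mul, hWt,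
      hPt, Matrix.trace_mul_comm, Matrix.mul_assoc, Matrix.trace_mul_comm]
    simp only [Matrix.mul_assoc]
  have h4 := abs_le.mp (abs_frobInner_partnership_sub_le hB (P * W)
    (fun a a' b h => partnership_mul_congr W b h) hω)
  have h5 := abs_le.mp (abs_frobInner_partnership_sub_le hB (P * (W * P))
    (fun a a' b h => partnership_mul_congr (W * P) b h)
    (by rw [← Matrix.mul_assoc]; exact abs_mul_partnership_le hω))
  have h6 := frobInner_le_mul_trace hW (residual_posSemidef (g := g) hB.1)
  have hsum : frobInner W (P - B) = frobInner W (P * (P - B)) + frobInner W ((P - B) * P)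
      - frobInner W (P * (P - B) * P) - frobInner W (residual g B) := by
    conv_lhs => rw [← hR]
    simp only [frobInner_eq_trace, mul_sub, mul_add, Matrix.trace_sub, Matrix.trace_add]
  rw [hsum, h1, h2, h3]
  linarith [h4.1, h5.2]

/-- An element of `C₀` without mass outside of the groups and without residual is `B*`. -/
lemma eq_partnership_of_offMass_of_trace {B : Matrix (Fin p) (Fin p) ℝ} (hB : B ∈ domainC0 p)
    (h0 : ∀ a b, g a ≠ g b → B a b = 0) (hr : (residual g B).trace = 0) : B = partnership g := by
  have hres : residual g B = 0 :=
    (residual_posSemidef hB.1).trace_eq_zero_iff.mp hr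
  have hPB : partnership g * B = partnership g := by
    ext a b
    rw [Matrix.mul_apply, partnership_apply]
    split_ifs with h
    · have h1 : ∀ c, partnership g a c * B c b = 1 / (groupSize g (g a) : ℝ) * B c b := by
        intro c
        rw [partnership_apply]
        split_ifs with h2
        · rfl
        · rw [h0 c b (fun h3 => h2 (h.trans h3.symm))]; simp
      rw [Finset.sum_congr rfl fun c _ => h1 c, ← Finset.mul_sum, hB.2.1 b, mul_one]
    · refine Finset.sum_eq_zero fun c _ => ?_
      rw [partnership_apply]
      split_ifs with h2
      · rw [h0 c b (fun h3 => h (h2.trans h3)), mul_zero]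
      · rw [zero_mul]
  have hBP : B * partnership g = partnership g := by
    have := congrArg Matrix.transpose hPB
    rwa [Matrix.transpose_mul, partnership_transpose, domainC0_transpose hB] at this
  -- Once `B` is block diagonal, `P B = B P = P`, so the residual is `B - P`.
  rw [residual, mul_sub, sub_mul, mul_one, one_mul, hPB, sub_mul, hBP, partnership_mul_self] at hres
  simpa [sub_eq_zero] using hres

end Partnership

/-! ### The normalized scalar product -/

section EmpInner

variable {n : ℕ}

/-- The scalar product of two samples, normalized by the sample size. -/
def empInner (x y : Fin n → ℝ) : ℝ := (1 / (n : ℝ)) * (x ⬝ᵥ y)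

lemma empInner_comm (x y : Fin n → ℝ) : empInner x y = empInner y x := by
  rw [empInner, empInner, dotProduct_comm]

lemma empInner_add_left (x x' y : Fin n → ℝ) :
    empInner (x + x') y = empInner x y + empInner x' y := by
  simp only [empInner, add_dotProduct, mul_add]

lemma empInner_sub_left (x x' y : Fin n → ℝ) :
    empInner (x - x') y = empInner x y - empInner x' y := by
  simp only [empInner, sub_dotProduct, mul_sub]

lemma empInner_smul_left (c : ℝ) (x y : Fin n → ℝ) :
    empInner (c • x) y = c * empInner x y := by
  simp only [empInner, smul_dotProduct, smul_eq_mul]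
  ring

lemma empInner_add_right (x y y' : Fin n → ℝ) :
    empInner x (y + y') = empInner x y + empInner x y' := by
  simp only [empInner, dotProduct_add, mul_add]

lemma empInner_sub_right (x y y' : Fin n → ℝ) :
    empInner x (y - y') = empInner x y - empInner x y' := by
  simp only [empInner, dotProduct_sub, mul_sub]

lemma empInner_smul_right (c : ℝ) (x y : Fin n → ℝ) :
    empInner x (c • y) = c * empInner x y := by
  simp only [empInner, dotProduct_smul, smul_eq_mul]
  ring

lemma empInner_sum_left {ι : Type*} (s : Finset ι) (x : ι → Fin n → ℝ) (y : Fin n → ℝ) :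
    empInner (∑ i ∈ s, x i) y = ∑ i ∈ s, empInner (x i) y := by
  simp only [empInner, sum_dotProduct, Finset.mul_sum]

lemma empInner_self_nonneg (x : Fin n → ℝ) : 0 ≤ empInner x x :=
  mul_nonneg (by positivity) (Finset.sum_nonneg fun i _ => mul_self_nonneg (x i))

lemma abs_empInner_le (x y : Fin n → ℝ) :
    2 * |empInner x y| ≤ empInner x x + empInner y y := by
  have h1 := empInner_self_nonneg (x + y)
  have h2 := empInner_self_nonneg (x - y)
  simp only [empInner_add_left, empInner_add_right, empInner_sub_left, empInner_sub_right] at h1 h2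
  rw [empInner_comm y x] at h1 h2
  rcases abs_cases (empInner x y) with ⟨h, -⟩ | ⟨h, -⟩ <;> rw [h] <;> linarith

/-- This holds for `u = 0` as well, since the inverse of 0 is 0 on both sides, in agreement with the
convention `0/0 = 0`. -/
lemma abs_dotProduct_normalized (hn : 0 < n) (x u : Fin n → ℝ) :
    |x ⬝ᵥ ((l2Norm u)⁻¹ • u)| = √n * (|empInner x u| * (√(empInner u u))⁻¹) := by
  have hN : (0 : ℝ) < n := by exact_mod_cast hn
  have h1 : l2Norm u = √n * √(empInner u u) := by
    rw [l2Norm, empInner, ← Real.sqrt_mul hN.le]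
    congr 1
    rw [dotProduct]
    field_simp
  have h2 : x ⬝ᵥ u = n * empInner x u := by
    rw [empInner]
    field_simp
  have h3 : (√(n : ℝ))⁻¹ * n = √n := by
    rw [inv_mul_eq_div, Real.div_sqrt]
  rw [dotProduct_smul, smul_eq_mul, abs_mul, abs_inv, h1, h2, abs_mul (n : ℝ), abs_of_pos hN,
    abs_of_nonneg (mul_nonneg (Real.sqrt_nonneg _) (Real.sqrt_nonneg _)), mul_inv]
  calc _ = ((√(n : ℝ))⁻¹ * n) * (|empInner x u| * (√(empInner u u))⁻¹) := by ring
    _ = _ := by rw [h3]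

end EmpInner

/-! ### The good event -/

/-- The regularity conditions on the samples `z` of the latent vector and `ε` of the normalized
errors on which the estimator recovers the groups. -/
structure IsRegularSample {n p K : ℕ} (g : Fin p → Fin K) (w : Fin K → Fin K → ℝ)
    (z : Fin K → Fin n → ℝ) (ε : Fin p → Fin n → ℝ) (θ L : ℝ) : Prop where
  noise_self : ∀ a, |empInner (ε a) (ε a) - 1| ≤ θ
  noise_ne : ∀ a b, a ≠ b → |empInner (ε a) (ε b)| ≤ θ
  latent_self : ∀ j k, |empInner (z j - z k) (z j - z k) - w j k ^ 2| ≤ θ * w j k ^ 2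
  latent_noise : ∀ j k a, |empInner (z j - z k) (ε a)| ≤ θ * w j k
  group_noise : ∀ k a, |empInner (∑ c with g c = k ∧ c ≠ a, ε c) (ε a)|
    ≤ θ * √(groupSize g k)
  operator : ∀ x : Fin p → ℝ,
    empInner (∑ a, x a • ε a) (∑ a, x a • ε a) ≤ (1 + L) * ∑ a, x a ^ 2

section Regular

variable {n p K : ℕ} {g : Fin p → Fin K} {w : Fin K → Fin K → ℝ}
    {z : Fin K → Fin n → ℝ} {ε : Fin p → Fin n → ℝ} {θ L : ℝ} {σ : Fin p → ℝ} {S : ℝ}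

/-- The difference of the samples of two variables. -/
def sampleDiff (g : Fin p → Fin K) (z : Fin K → Fin n → ℝ) (ε : Fin p → Fin n → ℝ)
    (σ : Fin p → ℝ) (c d : Fin p) : Fin n → ℝ :=
  z (g c) - z (g d) + σ c • ε c - σ d • ε d

lemma IsRegularSample.abs_noise_diff_le (h : IsRegularSample g w z ε θ L) (hσ : ∀ a, 0 ≤ σ a)
    {a c d : Fin p} (hac : a ≠ c) (had : a ≠ d) :
    |empInner (ε a) (sampleDiff g z ε σ c d)| ≤ θ * (w (g c) (g d) + σ c + σ d) := by
  have h1 := abs_le.mp (h.latent_noise (g c) (g d) a)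
  have h2 := abs_le.mp (h.noise_ne a c hac)
  have h3 := abs_le.mp (h.noise_ne a d had)
  rw [empInner_comm] at h1
  simp only [sampleDiff, empInner_sub_right _ _ (σ d • ε d), empInner_add_right,
    empInner_smul_right]
  have := hσ c
  have := hσ d
  rw [abs_le]
  constructor <;> nlinarith

lemma IsRegularSample.abs_noise_diff_self_le (h : IsRegularSample g w z ε θ L)
    (hσ : ∀ a, 0 ≤ σ a) {a d : Fin p} (had : a ≠ d) :
    |empInner (ε a) (sampleDiff g z ε σ a d) - σ a| ≤ θ * (w (g a) (g d) + σ a + σ d) := by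
  have h1 := abs_le.mp (h.latent_noise (g a) (g d) a)
  have h2 := abs_le.mp (h.noise_self a)
  have h3 := abs_le.mp (h.noise_ne a d had)
  rw [empInner_comm] at h1
  simp only [sampleDiff, empInner_sub_right _ _ (σ d • ε d), empInner_add_right,
    empInner_smul_right]
  have := hσ a
  have := hσ d
  rw [abs_le]
  constructor <;> nlinarith

lemma IsRegularSample.abs_latent_diff_le (h : IsRegularSample g w z ε θ L) (hσ : ∀ a, 0 ≤ σ a)
    (j k : Fin K) (c d : Fin p) :
    |empInner (z j - z k) (sampleDiff g z ε σ c d) - empInner (z j - z k) (z (g c) - z (g d))|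
      ≤ θ * w j k * (σ c + σ d) := by
  have h1 := abs_le.mp (h.latent_noise j k c)
  have h2 := abs_le.mp (h.latent_noise j k d)
  simp only [sampleDiff, empInner_sub_right _ _ (σ d • ε d), empInner_add_right,
    empInner_smul_right]
  have := hσ c
  have := hσ d
  rw [abs_le]
  constructor <;> nlinarith

lemma sampleDiff_inner (a b : Fin p) (u : Fin n → ℝ) :
    empInner (sampleDiff g z ε σ a b) u = empInner (z (g a) - z (g b)) u
      + σ a * empInner (ε a) u - σ b * empInner (ε b) u := by
  rw [sampleDiff, empInner_sub_left, empInner_add_left, empInner_smul_left, empInner_smul_left]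

lemma IsRegularSample.abs_diff_self_le (h : IsRegularSample g w z ε θ L) (hσ : ∀ a, 0 ≤ σ a)
    (hw : ∀ j k, 0 ≤ w j k) (hθ : 0 ≤ θ) {c d : Fin p} (hcd : c ≠ d) :
    |empInner (sampleDiff g z ε σ c d) (sampleDiff g z ε σ c d)
      - (w (g c) (g d) ^ 2 + σ c ^ 2 + σ d ^ 2)|
      ≤ 3 * θ * (w (g c) (g d) ^ 2 + σ c ^ 2 + σ d ^ 2) := by
  have h1 := abs_le.mp (h.latent_self (g c) (g d))
  have h2 := abs_le.mp (h.abs_latent_diff_le hσ (g c) (g d) c d)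
  have h3 := abs_le.mp (h.abs_noise_diff_self_le hσ hcd)
  have h4 : |empInner (ε d) (sampleDiff g z ε σ c d) + σ d|
      ≤ θ * (w (g c) (g d) + σ c + σ d) := by
    have h1 := abs_le.mp (h.latent_noise (g c) (g d) d)
    have h2 := abs_le.mp (h.noise_self d)
    have h3 := abs_le.mp (h.noise_ne d c hcd.symm)
    rw [empInner_comm] at h1
    simp only [sampleDiff, empInner_sub_right _ _ (σ d • ε d), empInner_add_right,
      empInner_smul_right]
    have := hσ c
    have := hσ d
    rw [abs_le]
    constructor <;> nlinarith
  have h4 := abs_le.mp h4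
  rw [sampleDiff_inner]
  generalize empInner (ε c) (sampleDiff g z ε σ c d) = A at *
  generalize empInner (ε d) (sampleDiff g z ε σ c d) = B at *
  generalize empInner (z (g c) - z (g d)) (sampleDiff g z ε σ c d) = C at *
  generalize empInner (z (g c) - z (g d)) (z (g c) - z (g d)) = D at *
  have hwcd := hw (g c) (g d)
  generalize w (g c) (g d) = v at *
  have hc := hσ c
  have hd := hσ d
  generalize σ c = x at *
  generalize σ d = y at *
  have e1 : θ * (2 * (v * x)) ≤ θ * (v ^ 2 + x ^ 2) := by gcongr; nlinarith [sq_nonneg (v - x)]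
  have e2 : θ * (2 * (v * y)) ≤ θ * (v ^ 2 + y ^ 2) := by gcongr; nlinarith [sq_nonneg (v - y)]
  have e3 : θ * (2 * (x * y)) ≤ θ * (x ^ 2 + y ^ 2) := by gcongr; nlinarith [sq_nonneg (x - y)]
  have f1 := mul_le_mul_of_nonneg_left h3.1 hc
  have f2 := mul_le_mul_of_nonneg_left h3.2 hc
  have f3 := mul_le_mul_of_nonneg_left h4.1 hd
  have f4 := mul_le_mul_of_nonneg_left h4.2 hd
  rw [abs_le]
  constructor <;> nlinarith

/-- The relative bound `latent_self` at `j = k` reads `w² ≤ θ w²`, which is impossible for `w ≠ 0`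
when `θ < 1`. -/
lemma IsRegularSample.latent_eq_zero (h : IsRegularSample g w z ε θ L) (hθ : θ ≤ 1 / 100)
    (k : Fin K) : w k k = 0 := by
  have h1 := h.latent_self k k
  rw [sub_self] at h1
  have h2 : empInner (0 : Fin n → ℝ) 0 = 0 := by simp [empInner]
  rw [h2, zero_sub, abs_neg, abs_of_nonneg (sq_nonneg _)] at h1
  have : w k k ^ 2 = 0 := le_antisymm (by nlinarith [sq_nonneg (w k k)]) (sq_nonneg _)
  exact pow_eq_zero_iff two_ne_zero |>.mp this

/-! ### The neighbors -/

section Neighbors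

variable {X : Matrix (Fin n) (Fin p) ℝ}

/-- Within a group the latent parts cancel, and the two remaining errors are almost orthogonal to
`X_c - X_d` because `c` and `d` avoid `a` and `b`. Numerator and norm are both of the order of `w +
σ_c + σ_d`, so the bound is independent of the latent distances. -/
lemma IsRegularSample.colDissim_le (h : IsRegularSample g w z ε θ L) (hn : 0 < n)
    (hX : ∀ a, X.col a = z (g a) + σ a • ε a)
    (hσ : ∀ a, 0 ≤ σ a) (hS : ∀ a, σ a ≤ S) (hw : ∀ j k, 0 ≤ w j k) (hθ0 : 0 ≤ θ)
    (hθ : θ ≤ 1 / 100) {a b : Fin p} (hab : g a = g b) :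
    colDissim X a b ≤ √n * (5 * θ * S) := by
  have hdiff : ∀ c d, X.col c - X.col d = sampleDiff g z ε σ c d := fun c d => by
    rw [hX, hX, sampleDiff]; abel
  have hS0 : 0 ≤ S := (hσ a).trans (hS a)
  refine Real.iSup_le (fun cd => ?_) (by positivity)
  obtain ⟨⟨c, hca, hcb⟩, d, hda, hdb⟩ := cd
  simp only
  rw [abs_dotProduct_normalized hn, hdiff, hdiff]
  refine mul_le_mul_of_nonneg_left ?_ (Real.sqrt_nonneg _)
  by_cases hcd : c = d
  · have : sampleDiff g z ε σ c d = 0 := by simp [sampleDiff, hcd]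
    rw [this]
    simp only [empInner, dotProduct_zero, mul_zero, abs_zero, zero_mul]
    positivity
  set u := sampleDiff g z ε σ c d
  have h1 := abs_le.mp (h.abs_noise_diff_le hσ (Ne.symm hca) (Ne.symm hda))
  have h2 := abs_le.mp (h.abs_noise_diff_le hσ (Ne.symm hcb) (Ne.symm hdb))
  have h3 := (abs_le.mp (h.abs_diff_self_le hσ hw hθ0 hcd)).1
  have hnum : |empInner (sampleDiff g z ε σ a b) u| ≤ 2 * S * (θ * (w (g c) (g d) + σ c + σ d)) := by
    have h0 : empInner (z (g a) - z (g b)) u = 0 := by rw [hab]; simp [empInner]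
    rw [sampleDiff_inner, h0, abs_le]
    have := hσ a
    have := hσ b
    have := hS a
    have := hS b
    constructor <;> nlinarith
  have hv := hw (g c) (g d)
  have hc := hσ c
  have hd := hσ d
  generalize w (g c) (g d) = v at *
  generalize σ c = x at *
  generalize σ d = y at *
  have hsq : 2 / 5 * (v + x + y) ≤ √(empInner u u) := by
    apply Real.le_sqrt_of_sq_le
    nlinarith [sq_nonneg (v - x), sq_nonneg (v - y), sq_nonneg (x - y), sq_nonneg v, sq_nonneg x,
      sq_nonneg y]
  rcases (Real.sqrt_nonneg (empInner u u)).eq_or_lt with h0 | h0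
  · rw [← h0, inv_zero, mul_zero]
    positivity
  · rw [← div_eq_mul_inv, div_le_iff₀ h0]
    refine hnum.trans ?_
    have := mul_le_mul_of_nonneg_left hsq (by positivity : 0 ≤ 5 * θ * S)
    linarith

lemma sq_le_of_quadratic_bound {v S θ : ℝ} (hθ0 : 0 ≤ θ) (hθ : θ ≤ 1 / 100)
    (key : v ^ 2 - θ * v ^ 2 - θ * v * (2 * S) - 2 * (S * (θ * (v + 2 * S)))
      ≤ 5 * θ * S * (3 / 2 * v + 2 * S)) : v ^ 2 ≤ 32 * θ * S ^ 2 := by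
  have k2 : θ * v ^ 2 ≤ 1 / 100 * v ^ 2 := mul_le_mul_of_nonneg_right hθ (sq_nonneg v)
  have k3 : θ * (θ * S ^ 2) ≤ 1 / 100 * (θ * S ^ 2) :=
    mul_le_mul_of_nonneg_right hθ (mul_nonneg hθ0 (sq_nonneg S))
  have k4 := sq_nonneg (v - 20 * (θ * S))
  have k5 := mul_nonneg hθ0 (sq_nonneg S)
  have k6 : 0 ≤ v ^ 2 := sq_nonneg v
  linarith

/-- Testing `X_a - X_b` against `X_c - X_d` gives about `w²`, up to errors of order `θ S (w + S)`,
while the norm of `X_c - X_d` is at most of order `w + S`. A small `V(a,b)` therefore gives a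
quadratic inequality for `w`, solved in `sq_le_of_quadratic_bound`. Only `w = O(√θ S)` follows, but
`Γ̂` involves latent distances through products of two. -/
lemma IsRegularSample.latent_sq_le (h : IsRegularSample g w z ε θ L) (hn : 0 < n)
    (hX : ∀ a, X.col a = z (g a) + σ a • ε a)
    (hσ : ∀ a, 0 ≤ σ a) (hS : ∀ a, σ a ≤ S) (hw : ∀ j k, 0 ≤ w j k) (hθ0 : 0 ≤ θ)
    (hθ : θ ≤ 1 / 100) {a b c d : Fin p} (hca : c ≠ a) (hdb : d ≠ b) (hgc : g c = g a)
    (hgd : g d = g b) (hV : colDissim X a b ≤ √n * (5 * θ * S)) :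
    w (g a) (g b) ^ 2 ≤ 32 * θ * S ^ 2 := by
  have hS0 : 0 ≤ S := (hσ a).trans (hS a)
  by_cases hab : g a = g b
  · have : 0 ≤ 32 * θ * S ^ 2 := by positivity
    simpa [hab, h.latent_eq_zero hθ] using this
  have hdiff : ∀ c d, X.col c - X.col d = sampleDiff g z ε σ c d := fun c d => by
    rw [hX, hX, sampleDiff]; abel
  have hcb : c ≠ b := fun e => hab (by rw [← hgc, e])
  have hda : d ≠ a := fun e => hab (by rw [← hgd, e])
  have hcd : c ≠ d := fun e => hab (by rw [← hgc, ← hgd, e])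
  have hN : (0 : ℝ) < √n := Real.sqrt_pos.mpr (by exact_mod_cast hn)
  have hV2 := (le_ciSup (Set.finite_range _).bddAbove
    ((⟨c, hca, hcb⟩, ⟨d, hda, hdb⟩) : {c : Fin p // c ≠ a ∧ c ≠ b} × {d : Fin p // d ≠ a ∧ d ≠ b})
    ).trans hV
  simp only at hV2
  rw [abs_dotProduct_normalized hn, hdiff, hdiff] at hV2
  have hV3 := le_of_mul_le_mul_left hV2 hN
  have h3 := abs_le.mp (h.abs_diff_self_le hσ hw hθ0 hcd)
  have h1 := abs_le.mp (h.abs_noise_diff_le hσ (Ne.symm hca) (Ne.symm hda))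
  have h2 := abs_le.mp (h.abs_noise_diff_le hσ (Ne.symm hcb) (Ne.symm hdb))
  have h4 := abs_le.mp (h.abs_latent_diff_le hσ (g a) (g b) c d)
  have h5 := abs_le.mp (h.latent_self (g a) (g b))
  rw [sampleDiff_inner] at hV3
  have hv := hw (g a) (g b)
  rw [hgc, hgd] at h1 h2 h3 h4
  set u := sampleDiff g z ε σ c d
  have hc := hσ c
  have hd := hσ d
  have hcS := hS c
  have hdS := hS d
  have haS := hS a
  have hbS := hS b
  have ha0 := hσ a
  have hb0 := hσ b
  generalize w (g a) (g b) = v at *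
  generalize empInner (ε a) u = A at *
  generalize empInner (ε b) u = B at *
  generalize empInner (z (g a) - z (g b)) u = C at *
  generalize empInner (z (g a) - z (g b)) (z (g a) - z (g b)) = D at *
  generalize empInner u u = U at *
  generalize σ c = x at *
  generalize σ d = y at *
  generalize σ a = s at *
  generalize σ b = t at *
  have hU : (v ^ 2 + x ^ 2 + y ^ 2) / 2 ≤ U := by nlinarith [sq_nonneg v, sq_nonneg x, sq_nonneg y]
  have hU2 : U ≤ 2 * (v ^ 2 + 2 * S ^ 2) := by
    have : x ^ 2 ≤ S ^ 2 := by gcongr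
    have : y ^ 2 ≤ S ^ 2 := by gcongr
    nlinarith [sq_nonneg v, sq_nonneg x, sq_nonneg y]
  rcases (Real.sqrt_nonneg U).eq_or_lt with h0 | h0
  · have : U ≤ 0 := Real.sqrt_eq_zero'.mp h0.symm
    have : v ^ 2 ≤ 0 := by nlinarith [sq_nonneg v, sq_nonneg x, sq_nonneg y]
    refine this.trans (by positivity)
  rw [← div_eq_mul_inv, div_le_iff₀ h0] at hV3
  have hsq : √U ≤ 3 / 2 * v + 2 * S := by
    apply Real.sqrt_le_iff.mpr
    refine ⟨by positivity, ?_⟩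
    nlinarith [mul_nonneg hv hS0, sq_nonneg v]
  have hV4 : C + s * A - t * B ≤ 5 * θ * S * (3 / 2 * v + 2 * S) :=
    (le_abs_self _).trans (hV3.trans (mul_le_mul_of_nonneg_left hsq (by positivity)))
  have e1 : θ * v * (x + y) ≤ θ * v * (2 * S) := by gcongr; linarith
  have e2 : θ * (v + x + y) ≤ θ * (v + 2 * S) := by gcongr θ * ?_; linarith
  have e0 : 0 ≤ θ * (v + 2 * S) := by positivity
  have e3 : s * -(θ * (v + 2 * S)) ≤ s * A := mul_le_mul_of_nonneg_left (by linarith) ha0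
  have e4 : t * B ≤ t * (θ * (v + 2 * S)) := mul_le_mul_of_nonneg_left (by linarith) hb0
  have e5 : s * (θ * (v + 2 * S)) ≤ S * (θ * (v + 2 * S)) := mul_le_mul_of_nonneg_right haS e0
  have e6 : t * (θ * (v + 2 * S)) ≤ S * (θ * (v + 2 * S)) := mul_le_mul_of_nonneg_right hbS e0
  exact sq_le_of_quadratic_bound hθ0 hθ (by linarith)

/-- The error in `Γ̂_aa` splits as `D + (C - D) + s (A - s) - t B`, with `D` the latent scalar
product. `D` is `O(θ S²)` by the closeness of both neighbors, and the other terms carry a factor `θ`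
and factors at most `S`. -/
lemma abs_add_sub_sub_sq_le {A B C D s t r v v' S θ : ℝ} (hθ0 : 0 ≤ θ) (hθ : θ ≤ 1 / 100)
    (hs0 : 0 ≤ s) (hs : s ≤ S) (ht0 : 0 ≤ t) (ht : t ≤ S)
    (hr0 : 0 ≤ r) (hr : r ≤ S) (hvS : v ^ 2 ≤ 32 * θ * S ^ 2) (hvS' : v' ^ 2 ≤ 32 * θ * S ^ 2)
    (hD : 2 * |D| ≤ (v ^ 2 + θ * v ^ 2) + (v' ^ 2 + θ * v' ^ 2))
    (hC : |C - D| ≤ θ * v * (s + r)) (hA : |A - s| ≤ θ * (v' + s + r))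
    (hB : |B| ≤ θ * (v' + s + r)) :
    |C + s * A - t * B - s ^ 2| ≤ 100 * θ * S ^ 2 := by
  have hS0 : 0 ≤ S := hs0.trans hs
  have k0 : 0 ≤ θ * S ^ 2 := mul_nonneg hθ0 (sq_nonneg S)
  have k1 : θ * S ^ 2 ≤ 1 / 100 * S ^ 2 := mul_le_mul_of_nonneg_right hθ (sq_nonneg S)
  have e1 : θ * v ^ 2 ≤ 1 / 100 * v ^ 2 := mul_le_mul_of_nonneg_right hθ (sq_nonneg v)
  have e2 : θ * v' ^ 2 ≤ 1 / 100 * v' ^ 2 := mul_le_mul_of_nonneg_right hθ (sq_nonneg v')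
  have k2 : 0 ≤ S ^ 2 := sq_nonneg S
  have g1 : v ≤ S := abs_le_of_sq_le_sq' (by linarith) hS0 |>.2
  have g2 : v' ≤ S := abs_le_of_sq_le_sq' (by linarith) hS0 |>.2
  have e3 : |C - D| ≤ θ * S * (S + S) := hC.trans (by gcongr)
  have e4 : θ * (v' + s + r) ≤ θ * (S + S + S) := by gcongr
  have e5 : |s * (A - s)| ≤ S * (θ * (S + S + S)) := by
    rw [abs_mul, abs_of_nonneg hs0]
    exact mul_le_mul hs (hA.trans e4) (abs_nonneg _) hS0
  have e6 : |t * B| ≤ S * (θ * (S + S + S)) := by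
    rw [abs_mul, abs_of_nonneg ht0]
    exact mul_le_mul ht (hB.trans e4) (abs_nonneg _) hS0
  have e7 := abs_le.mp e3
  have e8 := abs_le.mp e5
  have e9 := abs_le.mp e6
  have e10 : |D| ≤ 50 * (θ * S ^ 2) := by linarith
  have e11 := abs_le.mp e10
  rw [abs_le]
  constructor <;> linarith [e7.1, e7.2, e8.1, e8.2, e9.1, e9.2, e11.1, e11.2]

lemma IsRegularSample.abs_gammaHat_sub_le (h : IsRegularSample g w z ε θ L) (hn : 0 < n)
    (hX : ∀ a, X.col a = z (g a) + σ a • ε a)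
    (hσ : ∀ a, 0 ≤ σ a) (hS : ∀ a, σ a ≤ S) (hw : ∀ j k, 0 ≤ w j k) (hθ0 : 0 ≤ θ)
    (hθ : θ ≤ 1 / 100) (hg : ∀ k, 3 ≤ groupSize g k) {ne₁ ne₂ : Fin p → Fin p}
    (hne : IsNeighborChoice X ne₁ ne₂) (a : Fin p) :
    |gammaHat X ne₁ ne₂ a a - σ a ^ 2| ≤ 100 * θ * S ^ 2 := by
  have hS0 : 0 ≤ S := (hσ a).trans (hS a)
  -- Three members per group are needed: the group of `a` must offer a candidate for `ne₂ a` besides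
  -- `a` and `ne₁ a`.
  have hexists : ∀ (k : Fin K) (c d : Fin p), ∃ b, g b = k ∧ b ≠ c ∧ b ≠ d := by
    intro k c d
    have h1 : ({c, d} : Finset (Fin p)).card < (Finset.univ.filter fun b => g b = k).card :=
      (Finset.card_le_two).trans_lt (hg k)
    obtain ⟨b, hb, hb2⟩ := Finset.exists_mem_notMem_of_card_lt_card h1
    simp only [Finset.mem_insert, Finset.mem_singleton, not_or] at hb2
    exact ⟨b, (Finset.mem_filter.mp hb).2, hb2⟩
  have hclose : ∀ b, colDissim X a b ≤ √n * (5 * θ * S) →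
      w (g a) (g b) ^ 2 ≤ 32 * θ * S ^ 2 := by
    intro b hb
    obtain ⟨c, hc, hca, -⟩ := hexists (g a) a a
    obtain ⟨d, hd, hdb, -⟩ := hexists (g b) b b
    exact h.latent_sq_le hn hX hσ hS hw hθ0 hθ hca hdb hc hd hb
  have hw1 : w (g a) (g (ne₁ a)) ^ 2 ≤ 32 * θ * S ^ 2 := by
    obtain ⟨b, hb, hba, -⟩ := hexists (g a) a a
    exact hclose _ ((hne.ne₁_min a b hba).trans
      (h.colDissim_le hn hX hσ hS hw hθ0 hθ hb.symm))
  have hw2 : w (g a) (g (ne₂ a)) ^ 2 ≤ 32 * θ * S ^ 2 := by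
    obtain ⟨b, hb, hba, hb1⟩ := hexists (g a) a (ne₁ a)
    exact hclose _ ((hne.ne₂_min a b hba hb1).trans
      (h.colDissim_le hn hX hσ hS hw hθ0 hθ hb.symm))
  have hab := hne.ne₁_mem a
  obtain ⟨hac, hbc⟩ := hne.ne₂_mem a
  have hdiff : ∀ c d, X.col c - X.col d = sampleDiff g z ε σ c d := fun c d => by
    rw [hX, hX, sampleDiff]; abel
  have hval : gammaHat X ne₁ ne₂ a a
      = empInner (sampleDiff g z ε σ a (ne₁ a)) (sampleDiff g z ε σ a (ne₂ a)) := by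
    rw [gammaHat, Matrix.diagonal_apply_eq, hdiff, hdiff, empInner]
  generalize ne₁ a = b at *
  generalize ne₂ a = c at *
  rw [hval, sampleDiff_inner]
  have h1 := abs_le.mp (h.abs_noise_diff_self_le hσ hac.symm)
  have h2 := abs_le.mp (h.abs_noise_diff_le hσ hab hbc.symm)
  have h3 := abs_le.mp (h.abs_latent_diff_le hσ (g a) (g b) a c)
  have h4 := abs_empInner_le (z (g a) - z (g b)) (z (g a) - z (g c))
  have h5 := abs_le.mp (h.latent_self (g a) (g b))
  have h6 := abs_le.mp (h.latent_self (g a) (g c))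
  have hwb := hw (g a) (g b)
  have hwc := hw (g a) (g c)
  set u := sampleDiff g z ε σ a c
  generalize empInner (ε a) u = A at *
  generalize empInner (ε b) u = B at *
  generalize empInner (z (g a) - z (g b)) u = C at *
  generalize empInner (z (g a) - z (g b)) (z (g a) - z (g c)) = D at *
  generalize empInner (z (g a) - z (g b)) (z (g a) - z (g b)) = D1 at *
  generalize empInner (z (g a) - z (g c)) (z (g a) - z (g c)) = D2 at *
  generalize w (g a) (g b) = v at *
  generalize w (g a) (g c) = v' at *
  have ha0 := hσ a
  have haS := hS a
  have hb0 := hσ b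
  have hbS := hS b
  have hc0 := hσ c
  have hcS := hS c
  generalize σ a = s at *
  generalize σ b = t at *
  generalize σ c = r at *
  exact abs_add_sub_sub_sq_le hθ0 hθ ha0 haS hb0 hbS hc0 hcS hw1 hw2 (by linarith)
    (abs_le.mpr h3) (abs_le.mpr h1) (abs_le.mpr h2)

end Neighbors

end Regular

/-! ### Recovery on the good event -/

section SupNorm

variable {p : ℕ}

lemma abs_le_supNorm (A : Matrix (Fin p) (Fin p) ℝ) (a b : Fin p) : |A a b| ≤ supNorm A :=
  (le_ciSup (Set.finite_range fun b => |A a b|).bddAbove b).trans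
    (le_ciSup (Set.finite_range fun a => ⨆ b, |A a b|).bddAbove a)

lemma supNorm_le {A : Matrix (Fin p) (Fin p) ℝ} {c : ℝ} (hc : 0 ≤ c) (h : ∀ a b, |A a b| ≤ c) :
    supNorm A ≤ c :=
  Real.iSup_le (fun a => Real.iSup_le (fun b => h a b) hc) hc

end SupNorm

lemma exists_isNeighborChoice {n p : ℕ} (hp : 3 ≤ p) (X : Matrix (Fin n) (Fin p) ℝ) :
    ∃ ne₁ ne₂ : Fin p → Fin p, IsNeighborChoice X ne₁ ne₂ := by
  have hex : ∀ c d : Fin p, ∃ b, b ≠ c ∧ b ≠ d := by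
    intro c d
    have h1 : ({c, d} : Finset (Fin p)).card < (Finset.univ : Finset (Fin p)).card :=
      (Finset.card_le_two).trans_lt (by rw [Finset.card_fin]; omega)
    obtain ⟨b, -, hb2⟩ := Finset.exists_mem_notMem_of_card_lt_card h1
    simp only [Finset.mem_insert, Finset.mem_singleton, not_or] at hb2
    exact ⟨b, hb2⟩
  have hmin : ∀ a c : Fin p, ∃ b, (b ≠ a ∧ b ≠ c) ∧
      ∀ b', b' ≠ a → b' ≠ c → colDissim X a b ≤ colDissim X a b' := by
    intro a c
    obtain ⟨b₀, hb₀⟩ := hex a c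
    obtain ⟨b, hb, hb2⟩ := Finset.exists_min_image
      (Finset.univ.filter fun b => b ≠ a ∧ b ≠ c) (colDissim X a) ⟨b₀, by simpa using hb₀⟩
    exact ⟨b, by simpa using hb, fun b' h1 h2 => hb2 b' (by simp [h1, h2])⟩
  choose f hf1 hf2 using hmin
  exact ⟨fun a => f a a, fun a => f a (f a a), fun a => (hf1 a a).1,
    fun a b h => hf2 a a b h h, fun a => hf1 a _, fun a b h1 h2 => hf2 a _ b h1 h2⟩

/-! ### Deterministic comparison of `B*` with its competitors -/

section Recovery

variable {n p K : ℕ} {g : Fin p → Fin K} {w : Fin K → Fin K → ℝ}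
    {z : Fin K → Fin n → ℝ} {ε : Fin p → Fin n → ℝ} {θ L : ℝ} {σ : Fin p → ℝ} {S m : ℝ}

/-- The error part of `Σ̂ - Γ̂`. -/
def noiseMatrix (ε : Fin p → Fin n → ℝ) (σ : Fin p → ℝ) (Γ : Matrix (Fin p) (Fin p) ℝ) :
    Matrix (Fin p) (Fin p) ℝ :=
  Matrix.of fun a b => empInner (σ a • ε a) (σ b • ε b) - Γ a b

lemma noiseMatrix_transpose {d : Fin p → ℝ} :
    (noiseMatrix ε σ (Matrix.diagonal d))ᵀ = noiseMatrix ε σ (Matrix.diagonal d) := by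
  ext a b
  simp only [noiseMatrix, Matrix.transpose_apply, Matrix.of_apply]
  rw [empInner_comm]
  congr 1
  rw [← Matrix.transpose_apply (Matrix.diagonal d), Matrix.diagonal_transpose]

/-- The form is `|∑ x_a σ_a ε_a|² / n - ∑ d_a x_a²`. The subtracted diagonal removes the leading 1
of `1 + L`, up to the error `D` on the variances. -/
lemma IsRegularSample.quadratic_noise_le (h : IsRegularSample g w z ε θ L) (hL : 0 ≤ L)
    (hσ : ∀ a, 0 ≤ σ a) (hS : ∀ a, σ a ≤ S) {d : Fin p → ℝ} {D : ℝ}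
    (hd : ∀ a, |d a - σ a ^ 2| ≤ D) (x : Fin p → ℝ) :
    x ⬝ᵥ noiseMatrix ε σ (Matrix.diagonal d) *ᵥ x ≤ (L * S ^ 2 + D) * (x ⬝ᵥ x) := by
  have h1 : x ⬝ᵥ noiseMatrix ε σ (Matrix.diagonal d) *ᵥ x
      = empInner (∑ a, (x a * σ a) • ε a) (∑ a, (x a * σ a) • ε a) - ∑ a, d a * x a ^ 2 := by
    have h2 : noiseMatrix ε σ (Matrix.diagonal d)
        = (Matrix.of fun a b => empInner (σ a • ε a) (σ b • ε b)) - Matrix.diagonal d := rfl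
    rw [h2, Matrix.sub_mulVec, dotProduct_sub]
    congr 1
    · rw [empInner_sum_left]
      simp only [dotProduct, Matrix.mulVec, Matrix.of_apply, Finset.mul_sum]
      refine Finset.sum_congr rfl fun a _ => ?_
      rw [empInner_comm, empInner_sum_left]
      refine Finset.sum_congr rfl fun b _ => ?_
      simp only [empInner_smul_left, empInner_smul_right]
      rw [empInner_comm (ε b)]
      ring
    · simp only [dotProduct, Matrix.mulVec_diagonal]
      exact Finset.sum_congr rfl fun a _ => by ring
  rw [h1]
  have h2 := h.operator fun a => x a * σ a
  have h3 : (1 + L) * ∑ a, (x a * σ a) ^ 2 - ∑ a, d a * x a ^ 2 ≤ (L * S ^ 2 + D) * (x ⬝ᵥ x) := by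
    rw [dotProduct, Finset.mul_sum, Finset.mul_sum, ← Finset.sum_sub_distrib]
    refine Finset.sum_le_sum fun a _ => ?_
    have h4 := abs_le.mp (hd a)
    have h5 : σ a ^ 2 ≤ S ^ 2 := pow_le_pow_left₀ (hσ a) (hS a) 2
    have h6 : L * σ a ^ 2 ≤ L * S ^ 2 := mul_le_mul_of_nonneg_left h5 hL
    have h7 : (L * σ a ^ 2 + (σ a ^ 2 - d a)) * x a ^ 2 ≤ (L * S ^ 2 + D) * x a ^ 2 :=
      mul_le_mul_of_nonneg_right (by linarith) (sq_nonneg _)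
    linarith
  linarith

/-- Averaging the noise over a group of size `N` gains a factor `1/√N`, since the sum of the errors
over a group is of order `√N`. The diagonal entry, present when `b` is in the group, is not
centered: it carries the error of `Γ̂` and that of `|ε_b|²`, at most `101 θ S²` together, but is
divided by `N ≥ √N`. -/
lemma IsRegularSample.abs_partnership_mul_noise_le (h : IsRegularSample g w z ε θ L)
    (hσ : ∀ a, 0 ≤ σ a) (hS : ∀ a, σ a ≤ S) (hσg : ∀ a b, g a = g b → σ a = σ b)
    (hm : 1 ≤ m) (hmg : ∀ k, m ≤ groupSize g k) (hθ0 : 0 ≤ θ)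
    {d : Fin p → ℝ} (hd : ∀ a, |d a - σ a ^ 2| ≤ 100 * θ * S ^ 2) (a b : Fin p) :
    |(partnership g * noiseMatrix ε σ (Matrix.diagonal d)) a b| ≤ 102 * θ * S ^ 2 / √m := by
  have hb0 := hσ b
  have hbS := hS b
  have hS0 : 0 ≤ S := hb0.trans hbS
  set N : ℝ := ((groupSize g (g a) : ℕ) : ℝ) with hNdef
  have hmN : m ≤ N := hmg (g a)
  have hN : 0 < N := by linarith
  have hsm : 0 < √m := Real.sqrt_pos.mpr (by linarith)
  have hsN : 0 < √N := Real.sqrt_pos.mpr hN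
  have hNN : √N * √N = N := Real.mul_self_sqrt hN.le
  have hsmN : √m ≤ √N := Real.sqrt_le_sqrt hmN
  have hN1 : √N ≤ N := by
    have : 1 ≤ √N := Real.one_le_sqrt.mpr (hm.trans hmN)
    nlinarith
  have hval : (partnership g * noiseMatrix ε σ (Matrix.diagonal d)) a b
      = (σ a * σ b * empInner (∑ c with g c = g a ∧ c ≠ b, ε c) (ε b)) / N
        + (if g b = g a then (empInner (σ b • ε b) (σ b • ε b) - d b) / N else 0) := by
    rw [Matrix.mul_apply]
    have hterm : ∀ c, partnership g a c * noiseMatrix ε σ (Matrix.diagonal d) c b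
        = (if g c = g a ∧ c ≠ b then σ a * σ b * empInner (ε c) (ε b) / N else 0)
          + (if c = b then
              (if g b = g a then (empInner (σ b • ε b) (σ b • ε b) - d b) / N else 0) else 0) := by
      intro c
      rw [partnership_apply, ← hNdef]
      by_cases hcb : c = b
      · subst hcb
        by_cases hga : g c = g a
        · simp [hga, noiseMatrix, div_eq_inv_mul]
        · simp [hga, Ne.symm hga]
      · by_cases hga : g c = g a
        · simp only [hga, if_true, noiseMatrix, Matrix.of_apply, Matrix.diagonal_apply_ne _ hcb,
            sub_zero, empInner_smul_left, empInner_smul_right, hσg c a hga, hcb, ne_eq,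
            not_false_eq_true, and_self, if_false, add_zero]
          ring
        · simp [hga, Ne.symm hga, hcb]
    rw [Finset.sum_congr rfl fun c _ => hterm c, Finset.sum_add_distrib, ← Finset.sum_filter,
      Finset.sum_ite_eq' Finset.univ b, if_pos (Finset.mem_univ b), empInner_sum_left,
      Finset.mul_sum, Finset.sum_div]
  rw [hval]
  have h1 : |σ a * σ b * empInner (∑ c with g c = g a ∧ c ≠ b, ε c) (ε b) / N|
      ≤ θ * S ^ 2 / √m := by
    rw [abs_div, abs_of_pos hN, abs_mul, abs_of_nonneg (mul_nonneg (hσ a) hb0)]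
    have h2 : σ a * σ b ≤ S * S := mul_le_mul (hS a) hbS hb0 hS0
    have h3 := mul_le_mul h2 (h.group_noise (g a) b) (abs_nonneg _) (mul_nonneg hS0 hS0)
    rw [← hNdef] at h3
    calc _ ≤ S * S * (θ * √N) / N := by gcongr
      _ = θ * S ^ 2 / √N := by
        rw [div_eq_div_iff hN.ne' hsN.ne']
        linear_combination (S * S * θ) * hNN
      _ ≤ _ := by gcongr
  have h2 : |if g b = g a then (empInner (σ b • ε b) (σ b • ε b) - d b) / N else 0|
      ≤ 101 * θ * S ^ 2 / √m := by
    split_ifs with hga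
    · rw [abs_div, abs_of_pos hN]
      have h3 := abs_le.mp (h.noise_self b)
      have h4 := abs_le.mp (hd b)
      have h5 : σ b ^ 2 ≤ S ^ 2 := pow_le_pow_left₀ hb0 hbS 2
      have h6 : |empInner (σ b • ε b) (σ b • ε b) - d b| ≤ 101 * θ * S ^ 2 := by
        rw [empInner_smul_left, empInner_smul_right]
        have e1 := mul_le_mul_of_nonneg_left h3.1 (sq_nonneg (σ b))
        have e2 := mul_le_mul_of_nonneg_left h3.2 (sq_nonneg (σ b))
        have e3 : θ * σ b ^ 2 ≤ θ * S ^ 2 := mul_le_mul_of_nonneg_left h5 hθ0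
        rw [abs_le]
        constructor <;> linarith
      calc _ ≤ 101 * θ * S ^ 2 / N := by gcongr
        _ ≤ _ := by
          gcongr
          exact hsmN.trans hN1
    · rw [abs_zero]
      positivity
  refine (abs_add_le _ _).trans ((add_le_add h1 h2).trans (le_of_eq ?_))
  ring

lemma sampleCov_sub_eq {X : Matrix (Fin n) (Fin p) ℝ} (hX : ∀ a, X.col a = z (g a) + σ a • ε a)
    (Γ : Matrix (Fin p) (Fin p) ℝ) :
    sampleCov X - Γ = noiseMatrix ε σ Γ + (Matrix.of fun a b => empInner (z (g a)) (z (g b)))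
      + (Matrix.of fun a b => empInner (z (g a)) (σ b • ε b))
      + (Matrix.of fun a b => empInner (z (g a)) (σ b • ε b))ᵀ := by
  ext a b
  have h1 : sampleCov X a b = empInner (X.col a) (X.col b) := by
    simp [sampleCov, empInner, Matrix.mul_apply, dotProduct, Matrix.col]
  simp only [Matrix.sub_apply, Matrix.add_apply, Matrix.of_apply, Matrix.transpose_apply,
    noiseMatrix, h1, hX, empInner_add_left, empInner_add_right]
  rw [empInner_comm (σ a • ε a) (z (g b))]
  ring

lemma frobInner_transpose_of_comm (A : Matrix (Fin p) (Fin p) ℝ) {R : Matrix (Fin p) (Fin p) ℝ}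
    (hR : ∀ a b, R a b = R b a) : frobInner Aᵀ R = frobInner A R := by
  rw [frobInner, Finset.sum_comm]
  exact Finset.sum_congr rfl fun a _ => Finset.sum_congr rfl fun b _ => by
    rw [Matrix.transpose_apply, hR]

/-- Averaging the formula of `frobInner_partnership_sub` with the one obtained by exchanging `a` and
`b`, which the symmetry of `B` allows, completes the square. -/
lemma frobInner_gram_partnership_sub {B : Matrix (Fin p) (Fin p) ℝ} (hB : B ∈ domainC0 p)
    (z : Fin K → Fin n → ℝ) :
    frobInner (Matrix.of fun a b => empInner (z (g a)) (z (g b))) (partnership g - B)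
      = ∑ a, ∑ b, B a b * (1 / 2 * empInner (z (g a) - z (g b)) (z (g a) - z (g b))) := by
  have h1 := frobInner_partnership_sub (g := g) hB
    (Matrix.of fun a b => empInner (z (g a)) (z (g b))) (fun k b => empInner (z k) (z (g b)))
    (fun a b => rfl)
  have h2 : ∑ a, ∑ b, B a b * (empInner (z (g a)) (z (g b)) - empInner (z (g b)) (z (g b)))
      = ∑ a, ∑ b, B a b * (empInner (z (g a)) (z (g b)) - empInner (z (g a)) (z (g a))) := by
    rw [Finset.sum_comm]
    refine Finset.sum_congr rfl fun a _ => Finset.sum_congr rfl fun b _ => ?_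
    rw [domainC0_comm hB b a, empInner_comm (z (g b))]
  have h3 : ∑ a, ∑ b, B a b * (1 / 2 * empInner (z (g a) - z (g b)) (z (g a) - z (g b)))
      = -(1 / 2) * (∑ a, ∑ b, B a b * (empInner (z (g a)) (z (g b)) - empInner (z (g b)) (z (g b))))
        - (1 / 2) *
          ∑ a, ∑ b, B a b * (empInner (z (g a)) (z (g b)) - empInner (z (g a)) (z (g a))) := by
    simp only [Finset.mul_sum, ← Finset.sum_sub_distrib]
    refine Finset.sum_congr rfl fun a _ => Finset.sum_congr rfl fun b _ => ?_
    simp only [empInner_sub_left, empInner_sub_right]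
    rw [empInner_comm (z (g b)) (z (g a))]
    ring
  rw [h1, h3, ← h2]
  ring

/-- The penalized objective function. -/
def penalizedObjective (A : Matrix (Fin p) (Fin p) ℝ) (κ : ℝ) (B : Matrix (Fin p) (Fin p) ℝ) : ℝ :=
  frobInner A B - κ * B.trace

/-- The deterministic core. Signal, cross terms and averaged noise all become weights on the entries
`B a b`. The rest of the noise costs `l` times the trace of the residual, and the penalty pays `κ`
times this trace at the price of `κ/m` per unit of off-group mass. -/
lemma penalizedObjective_sub_ge {X : Matrix (Fin n) (Fin p) ℝ}
    (hX : ∀ a, X.col a = z (g a) + σ a • ε a) {B : Matrix (Fin p) (Fin p) ℝ}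
    (hB : B ∈ domainC0 p) {d : Fin p → ℝ} {ω l κ : ℝ} (hκ : 0 ≤ κ)
    (hω : ∀ a b, |(partnership g * noiseMatrix ε σ (Matrix.diagonal d)) a b| ≤ ω)
    (hl : ∀ x : Fin p → ℝ, x ⬝ᵥ noiseMatrix ε σ (Matrix.diagonal d) *ᵥ x ≤ l * (x ⬝ᵥ x))
    (hm : 0 < m) (hmg : ∀ k, m ≤ groupSize g k) :
    ∑ a, ∑ b, B a b * (1 / 2 * empInner (z (g a) - z (g b)) (z (g a) - z (g b))
        - 2 * (σ b * empInner (z (g a) - z (g b)) (ε b))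
        - (6 * ω + κ / m) * (if g a = g b then 0 else 1)) + (κ - l) * (residual g B).trace
      ≤ penalizedObjective (sampleCov X - Matrix.diagonal d) κ (partnership g)
        - penalizedObjective (sampleCov X - Matrix.diagonal d) κ B := by
  have h1 := frobInner_noise_ge hB noiseMatrix_transpose hω hl
  have h2 := frobInner_gram_partnership_sub (g := g) hB z
  have h3 := frobInner_partnership_sub (g := g) hB
    (Matrix.of fun a b => empInner (z (g a)) (σ b • ε b)) (fun k b => empInner (z k) (σ b • ε b))
    (fun a b => rfl)
  have h4 := frobInner_partnership_le hB hm hmg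
  have h5 := trace_residual (g := g) B
  have hR : ∀ a b, (partnership g - B) a b = (partnership g - B) b a := fun a b => by
    rw [Matrix.sub_apply, Matrix.sub_apply, partnership_comm, domainC0_comm hB]
  have h6 : penalizedObjective (sampleCov X - Matrix.diagonal d) κ (partnership g)
        - penalizedObjective (sampleCov X - Matrix.diagonal d) κ B
      = frobInner (sampleCov X - Matrix.diagonal d) (partnership g - B)
        - κ * ((partnership g).trace - B.trace) := by
    rw [penalizedObjective, penalizedObjective, frobInner_sub_right]
    ring
  rw [h6, sampleCov_sub_eq hX, frobInner_add_left, frobInner_add_left, frobInner_add_left,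
    frobInner_transpose_of_comm _ hR, h2, h3]
  have h7 : ∑ a, ∑ b, B a b * (1 / 2 * empInner (z (g a) - z (g b)) (z (g a) - z (g b))
        - 2 * (σ b * empInner (z (g a) - z (g b)) (ε b))
        - (6 * ω + κ / m) * (if g a = g b then 0 else 1))
      = ∑ a, ∑ b, B a b * (1 / 2 * empInner (z (g a) - z (g b)) (z (g a) - z (g b)))
        - 2 * ∑ a, ∑ b, B a b * (empInner (z (g a)) (σ b • ε b) - empInner (z (g b)) (σ b • ε b))
        - (6 * ω + κ / m) * offMass g B := by
    simp only [offMass, Finset.mul_sum, ← Finset.sum_sub_distrib]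
    refine Finset.sum_congr rfl fun a _ => Finset.sum_congr rfl fun b _ => ?_
    simp only [empInner_sub_left, empInner_smul_right]
    ring
  rw [h7]
  have h8 : κ * frobInner (partnership g) (partnership g - B) ≤ κ / m * offMass g B := by
    have := mul_le_mul_of_nonneg_left h4 hκ
    calc _ ≤ _ := this
      _ = _ := by ring
  have h9 : κ * ((partnership g).trace - B.trace)
      = κ * frobInner (partnership g) (partnership g - B) - κ * (residual g B).trace := by
    rw [h5]; ring
  rw [h9]
  linarith

/-- On the good event, any element of `C₀` that does at least as well as `B*` is `B*`. -/
lemma IsRegularSample.eq_partnership (h : IsRegularSample g w z ε θ L)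
    {X : Matrix (Fin n) (Fin p) ℝ} (hX : ∀ a, X.col a = z (g a) + σ a • ε a)
    (hσ : ∀ a, 0 ≤ σ a) (hS : ∀ a, σ a ≤ S) (hσg : ∀ a b, g a = g b → σ a = σ b)
    (hw : ∀ j k, 0 ≤ w j k) (hm : 1 ≤ m) (hmg : ∀ k, m ≤ groupSize g k)
    (hθ0 : 0 ≤ θ) (hθ : θ ≤ 1 / 100) (hL : 0 ≤ L) {d : Fin p → ℝ}
    (hd : ∀ a, |d a - σ a ^ 2| ≤ 100 * θ * S ^ 2) {κ : ℝ} (hκ : L * S ^ 2 + 100 * θ * S ^ 2 < κ)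
    (hsep : ∀ j k, j ≠ k → 8 * θ ^ 2 * S ^ 2 + 612 * θ * S ^ 2 / √m + κ / m < w j k ^ 2 / 4)
    {B : Matrix (Fin p) (Fin p) ℝ} (hB : B ∈ domainC0 p)
    (hle : penalizedObjective (sampleCov X - Matrix.diagonal d) κ (partnership g)
      ≤ penalizedObjective (sampleCov X - Matrix.diagonal d) κ B) : B = partnership g := by
  have hκ0 : 0 ≤ κ := le_trans (by positivity) hκ.le
  have h1 := penalizedObjective_sub_ge hX hB hκ0
    (h.abs_partnership_mul_noise_le hσ hS hσg hm hmg hθ0 hd)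
    (h.quadratic_noise_le hL hσ hS hd) (by linarith : 0 < m) hmg
  set H : Fin p → Fin p → ℝ := fun a b =>
    1 / 2 * empInner (z (g a) - z (g b)) (z (g a) - z (g b))
        - 2 * (σ b * empInner (z (g a) - z (g b)) (ε b))
        - (6 * (102 * θ * S ^ 2 / √m) + κ / m) * (if g a = g b then 0 else 1) with hH
  have hH0 : ∀ a b, g a = g b → H a b = 0 := by
    intro a b hab
    simp [hH, hab, empInner]
  have hH1 : ∀ a b, g a ≠ g b → 0 < H a b := by
    intro a b hab
    simp only [hH, if_neg hab]
    have e1 := (abs_le.mp (h.latent_self (g a) (g b))).1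
    have e2 := (abs_le.mp (h.latent_noise (g a) (g b) b)).2
    have e3 := hsep _ _ hab
    have e4 : σ b * empInner (z (g a) - z (g b)) (ε b) ≤ S * (θ * w (g a) (g b)) :=
      (mul_le_mul_of_nonneg_left e2 (hσ b)).trans
        (mul_le_mul_of_nonneg_right (hS b) (mul_nonneg hθ0 (hw _ _)))
    -- This gives `2 θ S w ≤ w²/8 + 8 θ² S²`, so that `w²/4` survives from `(1 - θ) w²/2`.
    have e5 := sq_nonneg (w (g a) (g b) - 8 * (θ * S))
    have e6 : θ * w (g a) (g b) ^ 2 ≤ 1 / 100 * w (g a) (g b) ^ 2 :=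
      mul_le_mul_of_nonneg_right hθ (sq_nonneg _)
    have e7 : 6 * (102 * θ * S ^ 2 / √m) = 612 * θ * S ^ 2 / √m := by ring
    have e8 := sq_nonneg (w (g a) (g b))
    rw [e7]
    linarith
  have hBH : ∀ a b, 0 ≤ B a b * H a b := by
    intro a b
    by_cases hab : g a = g b
    · rw [hH0 a b hab, mul_zero]
    · exact mul_nonneg (hB.2.2 a b) (hH1 a b hab).le
  have hsum : 0 ≤ ∑ a, ∑ b, B a b * H a b :=
    Finset.sum_nonneg fun a _ => Finset.sum_nonneg fun b _ => hBH a b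
  have hres : 0 ≤ (residual g B).trace := (residual_posSemidef hB.1).trace_nonneg
  have hres2 : 0 ≤ (κ - (L * S ^ 2 + 100 * θ * S ^ 2)) * (residual g B).trace :=
    mul_nonneg (by linarith) hres
  have hs0 : ∑ a, ∑ b, B a b * H a b = 0 := le_antisymm (by linarith) hsum
  have hr0 : (κ - (L * S ^ 2 + 100 * θ * S ^ 2)) * (residual g B).trace = 0 :=
    le_antisymm (by linarith) hres2
  refine eq_partnership_of_offMass_of_trace hB (fun a b hab => ?_) ?_
  · rw [Finset.sum_eq_zero_iff_of_nonneg
      (fun a _ => Finset.sum_nonneg fun b _ => hBH a b)] at hs0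
    have h2 := hs0 a (Finset.mem_univ a)
    rw [Finset.sum_eq_zero_iff_of_nonneg (fun b _ => hBH a b)] at h2
    exact (mul_eq_zero.mp (h2 b (Finset.mem_univ b))).resolve_right (hH1 a b hab).ne'
  · exact (mul_eq_zero.mp hr0).resolve_left (by linarith)

/-- On the good event, the estimator recovers the groups. -/
theorem IsRegularSample.adaptiveEstimators_eq {y : ℝ}
    (h : IsRegularSample g w z ε θ (497 / 100 * y))
    (hy : y = √((p : ℝ) / n) + (p : ℝ) / n) (hn : 0 < n) (hp : 3 ≤ p)
    {X : Matrix (Fin n) (Fin p) ℝ} (hX : ∀ a, X.col a = z (g a) + σ a • ε a)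
    (hσ : ∀ a, 0 ≤ σ a) (hS : ∀ a, σ a ≤ S) (hS0 : 0 < S) (hSmax : ∃ a, σ a = S)
    (hσg : ∀ a b, g a = g b → σ a = σ b)
    (hw : ∀ j k, 0 ≤ w j k) (hm : 1 ≤ m) (hmg : ∀ k, m ≤ groupSize g k)
    (hg : ∀ k, 3 ≤ groupSize g k)
    (hθ0 : 0 ≤ θ) (hθ : θ ≤ 1 / 100000) (hθy : 100 * θ ≤ 1 / 100 * y)
    (hsep : ∀ j k, j ≠ k → S ^ 2 * (3000 * (θ ^ 2 + θ / √m + y / m)) < w j k ^ 2) :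
    adaptiveEstimators X = {partnership g} := by
  have hpos : 0 < y := by
    rw [hy]
    have : (0 : ℝ) < n := by exact_mod_cast hn
    have : (0 : ℝ) < p := by exact_mod_cast (by omega : 0 < p)
    positivity
  have hS2 : 0 < S ^ 2 := by positivity
  have hkey : ∀ ne₁ ne₂, IsNeighborChoice X ne₁ ne₂ → ∀ B ∈ domainC0 p,
      penalizedObjective (sampleCov X - gammaHat X ne₁ ne₂) (kappaHat n (gammaHat X ne₁ ne₂))
        (partnership g)
      ≤ penalizedObjective (sampleCov X - gammaHat X ne₁ ne₂) (kappaHat n (gammaHat X ne₁ ne₂)) B →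
      B = partnership g := by
    intro ne₁ ne₂ hne B hB hle
    have hΓ := h.abs_gammaHat_sub_le hn hX hσ hS hw hθ0 (by linarith) hg hne
    obtain ⟨d, hd⟩ : ∃ d, gammaHat X ne₁ ne₂ = Matrix.diagonal d := ⟨_, rfl⟩
    rw [hd] at hΓ hle
    simp only [Matrix.diagonal_apply_eq] at hΓ
    have hθS : 100 * θ * S ^ 2 ≤ 1 / 1000 * S ^ 2 :=
      mul_le_mul_of_nonneg_right (by linarith) hS2.le
    -- The variance `S²` is attained, so `κ̂ ≥ 4.995 S² y`. This exceeds the noise eigenvalue bound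
    -- `4.97 S² y + 100 θ S² ≤ 4.98 S² y`.
    have hsup1 : 999 / 1000 * S ^ 2 ≤ supNorm (Matrix.diagonal d) := by
      obtain ⟨a, ha⟩ := hSmax
      have h1 := abs_le_supNorm (Matrix.diagonal d) a a
      rw [Matrix.diagonal_apply_eq] at h1
      have h2 := (abs_le.mp (hΓ a)).1
      rw [ha] at h2
      linarith [le_abs_self (d a)]
    have hsup2 : supNorm (Matrix.diagonal d) ≤ 6 / 5 * S ^ 2 := by
      refine supNorm_le (by positivity) fun a b => ?_
      by_cases hab : a = b
      · subst hab
        rw [Matrix.diagonal_apply_eq]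
        have h2 := abs_le.mp (hΓ a)
        have h3 : σ a ^ 2 ≤ S ^ 2 := pow_le_pow_left₀ (hσ a) (hS a) 2
        have h4 := sq_nonneg (σ a)
        rw [abs_le]
        constructor <;> linarith
      · rw [Matrix.diagonal_apply_ne _ hab, abs_zero]
        positivity
    have hκ : kappaHat n (Matrix.diagonal d) = 5 * supNorm (Matrix.diagonal d) * y := by
      rw [kappaHat, hy]
    have hκ1 : 5 * (999 / 1000 * S ^ 2) * y ≤ kappaHat n (Matrix.diagonal d) := by
      rw [hκ]; gcongr
    have hκ2 : kappaHat n (Matrix.diagonal d) ≤ 6 * S ^ 2 * y := by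
      rw [hκ]
      have : 5 * supNorm (Matrix.diagonal d) ≤ 6 * S ^ 2 := by linarith
      gcongr
    have hyS : 0 < S ^ 2 * y := by positivity
    refine h.eq_partnership hX hσ hS hσg hw hm hmg hθ0 (by linarith) (by positivity) hΓ
      (κ := kappaHat n (Matrix.diagonal d)) ?_ ?_ hB hle
    · have := mul_le_mul_of_nonneg_right hθy hS2.le
      linarith
    · intro j k hjk
      have h1 := hsep j k hjk
      have h2 : kappaHat n (Matrix.diagonal d) / m ≤ 6 * (S ^ 2 * (y / m)) := by
        rw [← mul_div_assoc, ← mul_div_assoc]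
        gcongr
        linarith
      have h3 : 612 * θ * S ^ 2 / √m = 612 * (S ^ 2 * (θ / √m)) := by ring
      have h4 : 0 ≤ S ^ 2 * (θ / √m) := by positivity
      have h5 : 0 ≤ S ^ 2 * (y / m) := by positivity
      have h6 : 0 ≤ S ^ 2 * θ ^ 2 := by positivity
      rw [h3]
      linarith
  ext Bhat
  rw [Set.mem_singleton_iff]
  constructor
  · rintro ⟨ne₁, ne₂, hne, hB, hmax⟩
    exact hkey ne₁ ne₂ hne Bhat hB (hmax partnership_mem_domainC0)
  · rintro rfl
    obtain ⟨ne₁, ne₂, hne⟩ := exists_isNeighborChoice hp X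
    refine ⟨ne₁, ne₂, hne, partnership_mem_domainC0, fun B hB => ?_⟩
    -- A strictly better competitor would also equal `B*`, so `B*` is a maximizer without any
    -- compactness argument.
    by_contra hcon
    have hlt : penalizedObjective (sampleCov X - gammaHat X ne₁ ne₂)
        (kappaHat n (gammaHat X ne₁ ne₂)) (partnership g)
        < penalizedObjective (sampleCov X - gammaHat X ne₁ ne₂)
          (kappaHat n (gammaHat X ne₁ ne₂)) B := not_le.mp fun hle => hcon hle
    have := hkey ne₁ ne₂ hne B hB hlt.le
    rw [this] at hlt
    exact lt_irrefl _ hlt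

end Recovery

/-! ### Gaussian vectors -/

section GaussianRow

variable {ι : Type*} [Fintype ι]

/-- The standard Gaussian distribution on `ι → ℝ`. -/
def gaussianRow (ι : Type*) [Fintype ι] : Measure (ι → ℝ) :=
  Measure.pi fun _ : ι => gaussianReal 0 1

instance : IsProbabilityMeasure (gaussianRow ι) := by
  unfold gaussianRow; infer_instance

lemma iIndepFun_gaussianRow : iIndepFun (fun (i : ι) (x : ι → ℝ) => x i) (gaussianRow ι) :=
  iIndepFun_pi (X := fun _ x => x) fun _ => aemeasurable_id

lemma gaussianRow_map_eval (i : ι) : (gaussianRow ι).map (fun x => x i) = gaussianReal 0 1 :=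
  (measurePreserving_eval (fun _ : ι => gaussianReal 0 1) i).map_eq

lemma hasGaussianLaw_eval_gaussianRow (i : ι) :
    HasGaussianLaw (fun x : ι → ℝ => x i) (gaussianRow ι) :=
  ⟨by rw [gaussianRow_map_eval]; infer_instance⟩

lemma hasGaussianLaw_gaussianRow : HasGaussianLaw (fun x : ι → ℝ => x) (gaussianRow ι) :=
  iIndepFun_gaussianRow.hasGaussianLaw hasGaussianLaw_eval_gaussianRow

lemma integral_eval_gaussianRow (i : ι) : ∫ x, x i ∂(gaussianRow ι) = 0 := by
  have h : ∫ x, x ∂((gaussianRow ι).map fun x => x i) = 0 := by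
    rw [gaussianRow_map_eval, integral_id_gaussianReal]
  rwa [integral_map (measurable_pi_apply i).aemeasurable (by fun_prop)] at h

open scoped Classical in
lemma covariance_eval_gaussianRow (i j : ι) :
    covariance (fun x => x i) (fun x => x j) (gaussianRow ι) = if i = j then 1 else 0 := by
  split_ifs with h
  · subst h
    rw [covariance_self (measurable_pi_apply i).aemeasurable]
    have h1 : Var[fun x => x; (gaussianRow ι).map fun x => x i] = 1 := by
      rw [gaussianRow_map_eval]
      simp
    have hm : Measurable fun x : ι → ℝ => x i := measurable_pi_apply i
    rw [variance_map (X := fun x : ℝ => x) aemeasurable_id hm.aemeasurable] at h1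
    exact h1
  · exact (iIndepFun_gaussianRow.indepFun h).covariance_eq_zero
      (hasGaussianLaw_eval_gaussianRow i).memLp_two (hasGaussianLaw_eval_gaussianRow j).memLp_two

lemma integral_dotProduct_gaussianRow (y : ι → ℝ) : ∫ x, x ⬝ᵥ y ∂(gaussianRow ι) = 0 := by
  simp only [dotProduct]
  rw [integral_finsetSum]
  · simp [integral_mul_const, integral_eval_gaussianRow]
  · exact fun i _ => (hasGaussianLaw_eval_gaussianRow i).integrable.mul_const _

lemma covariance_dotProduct_gaussianRow (y y' : ι → ℝ) :
    covariance (fun x => x ⬝ᵥ y) (fun x => x ⬝ᵥ y') (gaussianRow ι) = y ⬝ᵥ y' := by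
  classical
  simp only [dotProduct]
  rw [covariance_fun_sum_fun_sum
    (fun i => (hasGaussianLaw_eval_gaussianRow i).memLp_two.mul_const _)
    (fun i => (hasGaussianLaw_eval_gaussianRow i).memLp_two.mul_const _)]
  simp [covariance_mul_const_left, covariance_mul_const_right, covariance_eval_gaussianRow]

/-- The continuous linear functional `x ↦ x ⬝ᵥ y`. -/
def dotProductCLM (y : ι → ℝ) : (ι → ℝ) →L[ℝ] ℝ := ∑ i, y i • ContinuousLinearMap.proj i

lemma dotProductCLM_apply (y x : ι → ℝ) : dotProductCLM y x = x ⬝ᵥ y := by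
  simp [dotProductCLM, dotProduct, mul_comm]

lemma hasGaussianLaw_dotProduct_gaussianRow (y : ι → ℝ) :
    HasGaussianLaw (fun x => x ⬝ᵥ y) (gaussianRow ι) := by
  simpa only [dotProductCLM_apply] using hasGaussianLaw_gaussianRow.map_fun (dotProductCLM y)

lemma gaussianRow_map_dotProduct {y : ι → ℝ} (hy : y ⬝ᵥ y = 1) :
    (gaussianRow ι).map (fun x => x ⬝ᵥ y) = gaussianReal 0 1 := by
  have h := hasGaussianLaw_dotProduct_gaussianRow y
  rw [h.map_eq_gaussianReal, integral_dotProduct_gaussianRow, ← covariance_self h.aemeasurable,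
    covariance_dotProduct_gaussianRow, hy, Real.toNNReal_one]

/-- The law of a centered Gaussian vector is determined by its covariances. -/
lemma HasGaussianLaw.map_eq_map_of_covariance_eq {p : ℕ} {Ω Ω' : Type*} [MeasurableSpace Ω]
    [MeasurableSpace Ω'] {P : Measure Ω} {Q : Measure Ω'} {X : Ω → Fin p → ℝ} {Y : Ω' → Fin p → ℝ}
    (hX : HasGaussianLaw X P) (hY : HasGaussianLaw Y Q)
    (hX0 : ∀ a, ∫ ω, X ω a ∂P = 0) (hY0 : ∀ a, ∫ ω, Y ω a ∂Q = 0)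
    (hcov : ∀ a b, covariance (fun ω => X ω a) (fun ω => X ω b) P
      = covariance (fun ω => Y ω a) (fun ω => Y ω b) Q) : P.map X = Q.map Y := by
  have := hX.isProbabilityMeasure
  have := hY.isProbabilityMeasure
  have := hX.isGaussian_map
  have := hY.isGaussian_map
  refine Measure.ext_of_charFunDual (funext fun l => ?_)
  -- The characteristic function of a Gaussian vector depends only on the mean and variance of each
  -- linear functional.
  rw [hX.charFunDual_map_eq, hY.charFunDual_map_eq]
  have hl : ∀ v : Fin p → ℝ, l v = ∑ a, v a * l (Pi.single a 1) := by
    intro v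
    conv_lhs => rw [← Finset.univ_sum_single v]
    rw [map_sum]
    refine Finset.sum_congr rfl fun a _ => ?_
    rw [← smul_eq_mul, ← map_smul, ← Pi.single_smul]
    simp
  have hlX : l ∘ X = fun ω => ∑ a, X ω a * l (Pi.single a 1) := funext fun ω => hl (X ω)
  have hlY : l ∘ Y = fun ω => ∑ a, Y ω a * l (Pi.single a 1) := funext fun ω => hl (Y ω)
  have hXa : ∀ a, HasGaussianLaw (fun ω => X ω a) P := fun a => hX.eval a
  have hYa : ∀ a, HasGaussianLaw (fun ω => Y ω a) Q := fun a => hY.eval a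
  have h1 : ∫ ω, (l ∘ X) ω ∂P = ∫ ω, (l ∘ Y) ω ∂Q := by
    rw [hlX, hlY, integral_finsetSum _ fun a _ => (hXa a).integrable.mul_const _,
      integral_finsetSum _ fun a _ => (hYa a).integrable.mul_const _]
    simp [integral_mul_const, hX0, hY0]
  have h2 : Var[l ∘ X; P] = Var[l ∘ Y; Q] := by
    rw [hlX, hlY, variance_fun_sum fun a => (hXa a).memLp_two.mul_const _,
      variance_fun_sum fun a => (hYa a).memLp_two.mul_const _]
    refine Finset.sum_congr rfl fun a _ => Finset.sum_congr rfl fun b _ => ?_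
    simp only [covariance_mul_const_left, covariance_mul_const_right, hcov]
  rw [h1, h2]

end GaussianRow

/-! ### The Gaussian design -/

section Design

variable {ι : Type*} [Fintype ι] {n : ℕ}

/-- The law of a matrix with independent standard Gaussian entries. -/
def gaussianDesign (n : ℕ) (ι : Type*) [Fintype ι] : Measure (Fin n → ι → ℝ) :=
  Measure.pi fun _ : Fin n => gaussianRow ι

instance : IsProbabilityMeasure (gaussianDesign n ι) := by
  unfold gaussianDesign; infer_instance

/-- The image of a vector by the design matrix. -/
def design (G : Fin n → ι → ℝ) (y : ι → ℝ) : Fin n → ℝ := fun i => G i ⬝ᵥ y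

@[simp]
lemma design_zero (G : Fin n → ι → ℝ) : design G 0 = 0 := by
  ext i; simp [design]

lemma design_add (G : Fin n → ι → ℝ) (y y' : ι → ℝ) :
    design G (y + y') = design G y + design G y' := by
  ext i; simp [design]

lemma design_sub (G : Fin n → ι → ℝ) (y y' : ι → ℝ) :
    design G (y - y') = design G y - design G y' := by
  ext i; simp [design]

lemma design_smul (G : Fin n → ι → ℝ) (c : ℝ) (y : ι → ℝ) : design G (c • y) = c • design G y := by
  ext i; simp [design]

lemma design_sum {κ : Type*} (G : Fin n → ι → ℝ) (s : Finset κ) (y : κ → ι → ℝ) :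
    design G (∑ k ∈ s, y k) = ∑ k ∈ s, design G (y k) := by
  ext i; simp [design, dotProduct_sum]

lemma continuous_empInner_design (y y' : ι → ℝ) :
    Continuous fun G : Fin n → ι → ℝ => empInner (design G y) (design G y') := by
  unfold empInner design dotProduct
  fun_prop

/-- For a unit vector the coordinates of its image are independent standard Gaussians, so `n` times
the squared normalized norm is chi-square with `n` degrees of freedom. -/
lemma measureReal_design_unit (hn : 0 < n) {y : ι → ℝ} (hy : y ⬝ᵥ y = 1) {t η : ℝ} (ht : 0 ≤ t)
    (hη : 2 * √(n * t) + 2 * t ≤ η * n) :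
    (gaussianDesign n ι).real {G | η < |empInner (design G y) (design G y) - 1|}
      ≤ 2 * Real.exp (-t) := by
  have hN : (0 : ℝ) < n := by exact_mod_cast hn
  have hm : Measurable fun x : ι → ℝ => x ⬝ᵥ y := by unfold dotProduct; fun_prop
  have hind : iIndepFun (fun (i : Fin n) (G : Fin n → ι → ℝ) => G i ⬝ᵥ y) (gaussianDesign n ι) :=
    iIndepFun_pi (X := fun _ x => x ⬝ᵥ y) fun _ => hm.aemeasurable
  have hlaw : ∀ i : Fin n, (gaussianDesign n ι).map (fun G => G i ⬝ᵥ y) = gaussianReal 0 1 := by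
    intro i
    have h1 := (measurePreserving_eval (fun _ : Fin n => gaussianRow ι) i).map_eq
    rw [← gaussianRow_map_dotProduct hy, ← h1, Measure.map_map hm (measurable_pi_apply i)]
    rfl
  refine le_trans (measureReal_mono ?_) (measureReal_abs_sum_sq_sub_ge hn
    (fun i => hm.comp (measurable_pi_apply i)) hind hlaw ht)
  intro G hG
  have hG : η < |empInner (design G y) (design G y) - 1| := hG
  have h1 : empInner (design G y) (design G y) - 1 = (∑ i, (G i ⬝ᵥ y) ^ 2 - n) / n := by
    rw [empInner, dotProduct]
    simp only [design, ← sq]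
    field_simp
  rw [h1, abs_div, abs_of_pos hN, lt_div_iff₀ hN] at hG
  exact (hη.trans hG.le)

lemma eq_zero_of_dotProduct_self {y : ι → ℝ} (h : y ⬝ᵥ y = 0) : y = 0 := by
  simpa using dotProduct_self_eq_zero.mp h

lemma measureReal_design_self (hn : 0 < n) (y : ι → ℝ) {t η : ℝ} (ht : 0 ≤ t)
    (hη : 2 * √(n * t) + 2 * t ≤ η * n) :
    (gaussianDesign n ι).real
      {G | η * (y ⬝ᵥ y) < |empInner (design G y) (design G y) - y ⬝ᵥ y|}
      ≤ 2 * Real.exp (-t) := by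
  have h0 : 0 ≤ y ⬝ᵥ y := Finset.sum_nonneg fun i _ => mul_self_nonneg (y i)
  rcases h0.eq_or_lt with h0 | h0
  · have hy := eq_zero_of_dotProduct_self h0.symm
    subst hy
    simp only [design_zero, dotProduct_zero, mul_zero, sub_zero, empInner, abs_zero, lt_self_iff_false]
    have : {G : Fin n → ι → ℝ | False} = ∅ := by ext; simp
    rw [this, measureReal_empty]
    positivity
  · have hs : 0 < √(y ⬝ᵥ y) := Real.sqrt_pos.mpr h0
    have hss : √(y ⬝ᵥ y) * √(y ⬝ᵥ y) = y ⬝ᵥ y := Real.mul_self_sqrt h0.le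
    set u := (√(y ⬝ᵥ y))⁻¹ • y with hu
    have hu1 : u ⬝ᵥ u = 1 := by
      rw [hu, smul_dotProduct, dotProduct_smul, smul_eq_mul, smul_eq_mul, ← mul_assoc, ← mul_inv,
        hss, inv_mul_cancel₀ h0.ne']
    refine le_trans (measureReal_mono ?_) (measureReal_design_unit hn hu1 ht hη)
    intro G hG
    have hG : η * (y ⬝ᵥ y) < |empInner (design G y) (design G y) - y ⬝ᵥ y| := hG
    change η < _
    rw [hu, design_smul, empInner_smul_left, empInner_smul_right, ← mul_assoc, ← mul_inv, hss]
    have h1 : (y ⬝ᵥ y)⁻¹ * empInner (design G y) (design G y) - 1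
        = (empInner (design G y) (design G y) - y ⬝ᵥ y) / (y ⬝ᵥ y) := by
      field_simp
    rw [h1, abs_div, abs_of_pos h0, lt_div_iff₀ h0]
    exact hG

/-- Polarization: for orthogonal vectors of norms `a` and `b`, the combinations `b y ± a y'` have
the same norm, and the difference of their empirical squared norms is `4 a b` times the scalar
product sought. -/
lemma measureReal_design_inner (hn : 0 < n) {y y' : ι → ℝ} (hyy : y ⬝ᵥ y' = 0) {t η : ℝ}
    (ht : 0 ≤ t) (hη : 2 * √(n * t) + 2 * t ≤ η * n) :
    (gaussianDesign n ι).real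
      {G | η * (√(y ⬝ᵥ y) * √(y' ⬝ᵥ y')) < |empInner (design G y) (design G y')|}
      ≤ 4 * Real.exp (-t) := by
  set a := √(y ⬝ᵥ y) with ha
  set b := √(y' ⬝ᵥ y') with hb
  have ha0 : 0 ≤ a := Real.sqrt_nonneg _
  have hb0 : 0 ≤ b := Real.sqrt_nonneg _
  have haa : y ⬝ᵥ y = a ^ 2 := (Real.sq_sqrt (Finset.sum_nonneg fun i _ => mul_self_nonneg _)).symm
  have hbb : y' ⬝ᵥ y' = b ^ 2 :=
    (Real.sq_sqrt (Finset.sum_nonneg fun i _ => mul_self_nonneg _)).symm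
  have hyy' : y' ⬝ᵥ y = 0 := by rw [dotProduct_comm, hyy]
  have hplus : (b • y + a • y') ⬝ᵥ (b • y + a • y') = 2 * (a ^ 2 * b ^ 2) := by
    simp only [add_dotProduct, dotProduct_add, smul_dotProduct, dotProduct_smul, smul_eq_mul, haa,
      hbb, hyy, hyy']
    ring
  have hminus : (b • y - a • y') ⬝ᵥ (b • y - a • y') = 2 * (a ^ 2 * b ^ 2) := by
    simp only [sub_dotProduct, dotProduct_sub, smul_dotProduct, dotProduct_smul, smul_eq_mul, haa,
      hbb, hyy, hyy']
    ring
  have h1 := measureReal_design_self hn (b • y + a • y') ht hη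
  have h2 := measureReal_design_self hn (b • y - a • y') ht hη
  rw [hplus] at h1
  rw [hminus] at h2
  refine le_trans (measureReal_mono ?_) ((measureReal_union_le _ _).trans
    ((add_le_add h1 h2).trans (by linarith)))
  intro G hG
  have hG : η * (a * b) < |empInner (design G y) (design G y')| := hG
  by_contra hcon
  rw [Set.mem_union, not_or] at hcon
  have c1 : |empInner (design G (b • y + a • y')) (design G (b • y + a • y'))
      - 2 * (a ^ 2 * b ^ 2)| ≤ η * (2 * (a ^ 2 * b ^ 2)) := not_lt.mp fun h => hcon.1 h
  have c2 : |empInner (design G (b • y - a • y')) (design G (b • y - a • y'))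
      - 2 * (a ^ 2 * b ^ 2)| ≤ η * (2 * (a ^ 2 * b ^ 2)) := not_lt.mp fun h => hcon.2 h
  replace c1 := abs_le.mp c1
  replace c2 := abs_le.mp c2
  simp only [design_add, design_sub, design_smul, empInner_add_left, empInner_add_right,
    empInner_sub_left, empInner_sub_right, empInner_smul_left, empInner_smul_right,
    empInner_comm (design G y') (design G y)] at c1 c2
  rcases (mul_nonneg ha0 hb0).eq_or_lt with h0 | h0
  · rw [← h0, mul_zero] at hG
    rcases mul_eq_zero.mp h0.symm with h0 | h0
    · rw [h0, sq, zero_mul] at haa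
      rw [eq_zero_of_dotProduct_self haa] at hG
      simp [empInner] at hG
    · rw [h0, sq, zero_mul] at hbb
      rw [eq_zero_of_dotProduct_self hbb] at hG
      simp [empInner] at hG
  · have h3 : (a * b) * |empInner (design G y) (design G y')| ≤ (a * b) * (η * (a * b)) := by
      rw [← abs_of_pos h0, ← abs_mul, abs_of_pos h0, abs_le]
      constructor <;> linarith
    exact absurd (le_of_mul_le_mul_left h3 h0) (not_le.mpr hG)

end Design

/-! ### The good event has large probability -/

section Operator

variable {n p : ℕ}

lemma empInner_sum_smul (ε : Fin p → Fin n → ℝ) (x : Fin p → ℝ) :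
    empInner (∑ a, x a • ε a) (∑ a, x a • ε a)
      = ∑ a, ∑ b, x a * (empInner (ε a) (ε b) * x b) := by
  rw [empInner_sum_left]
  refine Finset.sum_congr rfl fun a _ => ?_
  rw [empInner_comm, empInner_sum_left]
  refine Finset.sum_congr rfl fun b _ => ?_
  rw [empInner_smul_left, empInner_smul_right, empInner_comm (ε b)]
  ring

open scoped InnerProductSpace in
/-- A bound of the fluctuations of `|∑ x_a ε_a|²` on a net gives a bound everywhere. -/
lemma empInner_sum_smul_le_of_net (ε : Fin p → Fin n → ℝ) {s : Finset (EuclideanSpace ℝ (Fin p))}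
    (hs1 : ∀ y ∈ s, ‖y‖ = 1) (hs : ∀ x, ‖x‖ = 1 → ∃ y ∈ s, ‖x - y‖ ≤ 3 / 10) {τ : ℝ}
    (hτ : ∀ y ∈ s, |empInner (∑ a, y a • ε a) (∑ a, y a • ε a) - 1| ≤ τ) (x : Fin p → ℝ) :
    empInner (∑ a, x a • ε a) (∑ a, x a • ε a) ≤ (1 + τ / (103 / 125)) * ∑ a, x a ^ 2 := by
  let M : Matrix (Fin p) (Fin p) ℝ := (Matrix.of fun a b => empInner (ε a) (ε b)) - 1
  have hM : M.IsHermitian := by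
    refine Matrix.IsHermitian.sub ?_ Matrix.isHermitian_one
    ext a b
    simp [empInner_comm (ε b)]
  have hT := Matrix.isSymmetric_toEuclideanLin_iff.mpr hM
  have hq : ∀ y : EuclideanSpace ℝ (Fin p), ⟪M.toEuclideanLin y, y⟫_ℝ
      = empInner (∑ a, y a • ε a) (∑ a, y a • ε a) - ‖y‖ ^ 2 := by
    intro y
    rw [EuclideanSpace.real_norm_sq_eq, empInner_sum_smul, ← Finset.sum_sub_distrib]
    rw [PiLp.inner_apply]
    refine Finset.sum_congr rfl fun a _ => ?_
    have hMv : (M.toEuclideanLin y).ofLp a = ∑ b, empInner (ε a) (ε b) * y b - y a := by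
      change (M *ᵥ y.ofLp) a = _
      rw [Matrix.sub_mulVec, Matrix.one_mulVec]
      rfl
    rw [hMv, ← Finset.mul_sum]
    simp only [RCLike.inner_apply, RCLike.conj_to_real]
    ring
  have h1 := quadratic_le_of_net hT hs1 hs (τ := τ)
    (fun y hy => by rw [hq, hs1 y hy, one_pow]; exact hτ y hy) (WithLp.toLp 2 x)
  rw [hq, EuclideanSpace.real_norm_sq_eq] at h1
  have h2 := (abs_le.mp h1).2
  simp only at h2
  linarith

end Operator

/-! ### Gaussian realization of the samples and union bounds -/

section Regularity

variable {n p K r : ℕ}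

/-- The direction of the `k`-th latent variable. -/
def latentVec (p : ℕ) (v : Fin r → Fin K → ℝ) (k : Fin K) : Fin r ⊕ Fin p → ℝ :=
  Sum.elim (fun i => v i k) 0

/-- The direction of a linear combination of the normalized errors. -/
def noiseVec (r : ℕ) (x : Fin p → ℝ) : Fin r ⊕ Fin p → ℝ := Sum.elim 0 x

lemma noiseVec_dotProduct (x x' : Fin p → ℝ) : noiseVec r x ⬝ᵥ noiseVec r x' = x ⬝ᵥ x' := by
  simp [noiseVec, dotProduct]

lemma latentVec_dotProduct (v : Fin r → Fin K → ℝ) (j k : Fin K) :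
    latentVec p v j ⬝ᵥ latentVec p v k = ∑ i, v i j * v i k := by
  simp [latentVec, dotProduct]

lemma latentVec_dotProduct_noiseVec (v : Fin r → Fin K → ℝ) (k : Fin K) (x : Fin p → ℝ) :
    latentVec p v k ⬝ᵥ noiseVec r x = 0 := by
  simp [latentVec, noiseVec, dotProduct]

lemma sum_smul_noiseVec (s : Finset (Fin p)) (x : Fin p → ℝ) :
    ∑ a ∈ s, x a • noiseVec r (Pi.single a 1) = noiseVec r (fun a => if a ∈ s then x a else 0) := by
  ext i
  rcases i with i | b
  · simp [noiseVec, Finset.sum_apply]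
  · simp [noiseVec, Finset.sum_apply, Pi.single_apply]

/-- The sample of the latent vector. -/
def latentSample (v : Fin r → Fin K → ℝ) (G : Fin n → Fin r ⊕ Fin p → ℝ) (k : Fin K) : Fin n → ℝ :=
  design G (latentVec p v k)

/-- The sample of the normalized errors. -/
def noiseSample (G : Fin n → Fin r ⊕ Fin p → ℝ) (a : Fin p) : Fin n → ℝ :=
  design G (noiseVec r (Pi.single a 1))

/-- The standard deviation of the difference of two latent variables. -/
def latentDist (p : ℕ) (v : Fin r → Fin K → ℝ) (j k : Fin K) : ℝ :=
  √((latentVec p v j - latentVec p v k) ⬝ᵥ (latentVec p v j - latentVec p v k))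

lemma latentDist_sq (v : Fin r → Fin K → ℝ) (j k : Fin K) :
    latentDist p v j k ^ 2
      = (latentVec p v j - latentVec p v k) ⬝ᵥ (latentVec p v j - latentVec p v k) :=
  Real.sq_sqrt (Finset.sum_nonneg fun _ _ => mul_self_nonneg _)

lemma sum_smul_noiseSample (G : Fin n → Fin r ⊕ Fin p → ℝ) (x : Fin p → ℝ) :
    ∑ a, x a • noiseSample G a = design G (noiseVec r x) := by
  simp only [noiseSample, ← design_smul, ← design_sum]
  rw [sum_smul_noiseVec]
  simp

lemma sum_noiseSample (G : Fin n → Fin r ⊕ Fin p → ℝ) (s : Finset (Fin p)) :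
    ∑ a ∈ s, noiseSample G a = design G (noiseVec r fun a => if a ∈ s then 1 else 0) := by
  rw [← sum_smul_noiseVec s (fun _ => 1), design_sum]
  simp [noiseSample]

/-- Closedness, not just measurability, is what `measureReal_le_of_map_eq` needs; it survives the
uncountable intersection in the operator bound. -/
lemma isClosed_isRegularSample (g : Fin p → Fin K) (w : Fin K → Fin K → ℝ)
    (v : Fin r → Fin K → ℝ) (θ L : ℝ) :
    IsClosed {G : Fin n → Fin r ⊕ Fin p → ℝ |
      IsRegularSample g w (latentSample v G) (noiseSample G) θ L} := by
  have hset : {G : Fin n → Fin r ⊕ Fin p → ℝ |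
      IsRegularSample g w (latentSample v G) (noiseSample G) θ L}
      = {G | (∀ a, |empInner (noiseSample G a) (noiseSample G a) - 1| ≤ θ) ∧
        (∀ a b, a ≠ b → |empInner (noiseSample G a) (noiseSample G b)| ≤ θ) ∧
        (∀ j k, |empInner (latentSample v G j - latentSample v G k)
          (latentSample v G j - latentSample v G k) - w j k ^ 2| ≤ θ * w j k ^ 2) ∧
        (∀ j k a, |empInner (latentSample v G j - latentSample v G k) (noiseSample G a)|
          ≤ θ * w j k) ∧
        (∀ k a, |empInner (∑ c with g c = k ∧ c ≠ a, noiseSample G c) (noiseSample G a)|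
          ≤ θ * √(groupSize g k)) ∧
        ∀ x : Fin p → ℝ, empInner (∑ a, x a • noiseSample G a) (∑ a, x a • noiseSample G a)
          ≤ (1 + L) * ∑ a, x a ^ 2} := by
    ext G
    exact ⟨fun h => ⟨h.1, h.2, h.3, h.4, h.5, h.6⟩, fun h => ⟨h.1, h.2.1, h.2.2.1, h.2.2.2.1,
      h.2.2.2.2.1, h.2.2.2.2.2⟩⟩
  rw [hset]
  simp only [sum_smul_noiseSample, sum_noiseSample]
  simp only [latentSample, noiseSample, ← design_sub, Set.ofPred_and, Set.ofPred_forall]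
  have hc := continuous_empInner_design (ι := Fin r ⊕ Fin p) (n := n)
  refine IsClosed.inter ?_ (IsClosed.inter ?_ (IsClosed.inter ?_ (IsClosed.inter ?_
    (IsClosed.inter ?_ ?_))))
  · exact isClosed_iInter fun a => isClosed_le ((hc _ _).sub continuous_const).abs continuous_const
  · exact isClosed_iInter fun a => isClosed_iInter fun b => isClosed_iInter fun _ =>
      isClosed_le (hc _ _).abs continuous_const
  · exact isClosed_iInter fun a => isClosed_iInter fun b =>
      isClosed_le ((hc _ _).sub continuous_const).abs continuous_const
  · exact isClosed_iInter fun a => isClosed_iInter fun b => isClosed_iInter fun _ =>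
      isClosed_le (hc _ _).abs continuous_const
  · exact isClosed_iInter fun a => isClosed_iInter fun b =>
      isClosed_le (hc _ _).abs continuous_const
  · exact isClosed_iInter fun a => isClosed_le (hc _ _) continuous_const

lemma measureReal_exists_le {Ω κ : Type*} [MeasurableSpace Ω] [Fintype κ] (μ : Measure Ω)
    [IsProbabilityMeasure μ] {A : κ → Set Ω} {c : ℝ} (h : ∀ k, μ.real (A k) ≤ c) :
    μ.real {ω | ∃ k, ω ∈ A k} ≤ Fintype.card κ * c := by
  have h1 : {ω | ∃ k, ω ∈ A k} = ⋃ k, A k := by ext; simp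
  rw [h1]
  refine (measureReal_iUnion_fintype_le A).trans ((Finset.sum_le_sum fun k _ => h k).trans ?_)
  simp

/-- The probability that one of the scalar products in the definition of the good event deviates. -/
lemma measureReal_not_regular_le (hn : 0 < n) (g : Fin p → Fin K) (v : Fin r → Fin K → ℝ)
    {t θ : ℝ} (ht : 0 ≤ t) (hθ0 : 0 ≤ θ) (hθ : 2 * √(n * t) + 2 * t ≤ θ * n) (hK : K ≤ p) (hp : 1 ≤ p)
    {L : ℝ} {q : ℝ} (hq : (gaussianDesign n (Fin r ⊕ Fin p)).real {G | ¬ ∀ x : Fin p → ℝ,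
      empInner (∑ a, x a • noiseSample G a) (∑ a, x a • noiseSample G a)
        ≤ (1 + L) * ∑ a, x a ^ 2} ≤ q) :
    (gaussianDesign n (Fin r ⊕ Fin p)).real
      {G | ¬ IsRegularSample g (latentDist p v) (latentSample v G) (noiseSample G) θ L}
      ≤ 20 * (p : ℝ) ^ 3 * Real.exp (-t) + q := by
  set μ := gaussianDesign n (Fin r ⊕ Fin p) with hμ
  have hsingle : ∀ a : Fin p, (Pi.single a 1 : Fin p → ℝ) ⬝ᵥ Pi.single a 1 = 1 := by simp
  let A₁ : Fin p → Set (Fin n → Fin r ⊕ Fin p → ℝ) := fun a =>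
    {G | θ < |empInner (noiseSample G a) (noiseSample G a) - 1|}
  let A₂ : Fin p × Fin p → Set (Fin n → Fin r ⊕ Fin p → ℝ) := fun ab =>
    {G | ab.1 ≠ ab.2 ∧ θ < |empInner (noiseSample G ab.1) (noiseSample G ab.2)|}
  let A₃ : Fin K × Fin K → Set (Fin n → Fin r ⊕ Fin p → ℝ) := fun jk =>
    {G | θ * latentDist p v jk.1 jk.2 ^ 2
      < |empInner (latentSample v G jk.1 - latentSample v G jk.2)
          (latentSample v G jk.1 - latentSample v G jk.2) - latentDist p v jk.1 jk.2 ^ 2|}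
  let A₄ : (Fin K × Fin K) × Fin p → Set (Fin n → Fin r ⊕ Fin p → ℝ) := fun jka =>
    {G | θ * latentDist p v jka.1.1 jka.1.2
      < |empInner (latentSample v G jka.1.1 - latentSample v G jka.1.2) (noiseSample G jka.2)|}
  let A₅ : Fin K × Fin p → Set (Fin n → Fin r ⊕ Fin p → ℝ) := fun ka =>
    {G | θ * √(groupSize g ka.1)
      < |empInner (∑ c with g c = ka.1 ∧ c ≠ ka.2, noiseSample G c) (noiseSample G ka.2)|}
  have h₁ : ∀ a, μ.real (A₁ a) ≤ 4 * Real.exp (-t) := fun a => by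
    have h := measureReal_design_unit (ι := Fin r ⊕ Fin p) hn
      (y := noiseVec r (Pi.single a 1)) (by rw [noiseVec_dotProduct, hsingle]) ht hθ
    exact h.trans (by linarith [Real.exp_pos (-t)])
  have h₂ : ∀ ab, μ.real (A₂ ab) ≤ 4 * Real.exp (-t) := fun ⟨a, b⟩ => by
    by_cases hab : a = b
    · have : A₂ (a, b) = ∅ := by ext; simp [A₂, hab]
      rw [this, measureReal_empty]
      positivity
    · have h := measureReal_design_inner (ι := Fin r ⊕ Fin p) hn
        (y := noiseVec r (Pi.single a 1)) (y' := noiseVec r (Pi.single b 1))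
        (by rw [noiseVec_dotProduct]; simp [Ne.symm hab]) ht hθ
      simp only [noiseVec_dotProduct, hsingle, Real.sqrt_one, mul_one] at h
      exact (measureReal_mono fun G hG => hG.2).trans h
  have h₃ : ∀ jk, μ.real (A₃ jk) ≤ 4 * Real.exp (-t) := fun ⟨j, k⟩ => by
    have h := measureReal_design_self (ι := Fin r ⊕ Fin p) hn
      (latentVec p v j - latentVec p v k) ht hθ
    rw [← latentDist_sq] at h
    simp only [design_sub] at h
    exact h.trans (by linarith [Real.exp_pos (-t)])
  have h₄ : ∀ jka, μ.real (A₄ jka) ≤ 4 * Real.exp (-t) := fun ⟨⟨j, k⟩, a⟩ => by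
    have h := measureReal_design_inner (ι := Fin r ⊕ Fin p) hn
      (y := latentVec p v j - latentVec p v k) (y' := noiseVec r (Pi.single a 1))
      (by rw [sub_dotProduct, latentVec_dotProduct_noiseVec, latentVec_dotProduct_noiseVec,
        sub_zero]) ht hθ
    simp only [noiseVec_dotProduct, hsingle, Real.sqrt_one, mul_one, design_sub] at h
    exact h
  have h₅ : ∀ ka, μ.real (A₅ ka) ≤ 4 * Real.exp (-t) := fun ⟨k, a⟩ => by
    set s := Finset.univ.filter fun c => g c = k ∧ c ≠ a with hs
    have h := measureReal_design_inner (ι := Fin r ⊕ Fin p) hn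
      (y := noiseVec r fun c => if c ∈ s then 1 else 0) (y' := noiseVec r (Pi.single a 1))
      (by rw [noiseVec_dotProduct]; simp [hs]) ht hθ
    simp only [noiseVec_dotProduct, hsingle, Real.sqrt_one, mul_one] at h
    refine le_trans (measureReal_mono ?_) h
    intro G hG
    have hG : θ * √(groupSize g k)
      < |empInner (∑ c ∈ s, noiseSample G c) (noiseSample G a)| := hG
    rw [sum_noiseSample] at hG
    refine lt_of_le_of_lt ?_ hG
    refine mul_le_mul_of_nonneg_left (Real.sqrt_le_sqrt ?_) hθ0
    have hcard : ((fun c => if c ∈ s then 1 else 0 : Fin p → ℝ) ⬝ᵥ fun c => if c ∈ s then 1 else 0)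
        = s.card := by
      simp [dotProduct]
    rw [hcard]
    exact_mod_cast Finset.card_le_card fun c hc => by
      simp only [hs, Finset.mem_filter, Finset.mem_univ, true_and] at hc ⊢
      exact hc.1
  have hsub : {G | ¬ IsRegularSample g (latentDist p v) (latentSample v G) (noiseSample G) θ L}
      ⊆ ((((({G | ∃ k, G ∈ A₁ k} ∪ {G | ∃ k, G ∈ A₂ k}) ∪ {G | ∃ k, G ∈ A₃ k})
        ∪ {G | ∃ k, G ∈ A₄ k}) ∪ {G | ∃ k, G ∈ A₅ k}) ∪ {G | ¬ ∀ x : Fin p → ℝ,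
      empInner (∑ a, x a • noiseSample G a) (∑ a, x a • noiseSample G a)
        ≤ (1 + L) * ∑ a, x a ^ 2}) := by
    intro G hG
    by_contra hcon
    simp only [Set.mem_union, not_or] at hcon
    obtain ⟨⟨⟨⟨⟨c₁, c₂⟩, c₃⟩, c₄⟩, c₅⟩, c₆⟩ := hcon
    refine hG ⟨fun a => ?_, fun a b hab => ?_, fun j k => ?_, fun j k a => ?_, fun k a => ?_, ?_⟩
    · exact not_lt.mp fun h => c₁ ⟨a, h⟩
    · exact not_lt.mp fun h => c₂ ⟨(a, b), hab, h⟩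
    · exact not_lt.mp fun h => c₃ ⟨(j, k), h⟩
    · exact not_lt.mp fun h => c₄ ⟨((j, k), a), h⟩
    · exact not_lt.mp fun h => c₅ ⟨(k, a), h⟩
    · by_contra h
      exact c₆ h
  -- Each of the five families has at most `p³` events of probability at most `4 e^{-t}`, whence the
  -- factor 20.
  have hcount : ∀ {κ : Type} [Fintype κ] (A : κ → Set (Fin n → Fin r ⊕ Fin p → ℝ)),
      (∀ k, μ.real (A k) ≤ 4 * Real.exp (-t)) → Fintype.card κ ≤ p ^ 3 →
      μ.real {G | ∃ k, G ∈ A k} ≤ 4 * (p : ℝ) ^ 3 * Real.exp (-t) := by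
    intro κ _ A hA hcard
    have h1 : (Fintype.card κ : ℝ) ≤ (p : ℝ) ^ 3 := by exact_mod_cast hcard
    calc _ ≤ Fintype.card κ * (4 * Real.exp (-t)) := measureReal_exists_le μ hA
      _ ≤ (p : ℝ) ^ 3 * (4 * Real.exp (-t)) := by gcongr
      _ = _ := by ring
  have hpp : p * p ≤ p ^ 3 := by
    calc p * p = p ^ 2 := by ring
      _ ≤ p ^ 3 := Nat.pow_le_pow_right hp (by norm_num)
  have e₁ := hcount A₁ h₁ (by rw [Fintype.card_fin]; exact Nat.le_self_pow (by norm_num) p)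
  have e₂ := hcount A₂ h₂ (by rw [Fintype.card_prod, Fintype.card_fin]; exact hpp)
  have e₃ := hcount A₃ h₃ (by
    rw [Fintype.card_prod, Fintype.card_fin]
    exact (Nat.mul_le_mul hK hK).trans hpp)
  have e₄ := hcount A₄ h₄ (by
    rw [Fintype.card_prod, Fintype.card_prod, Fintype.card_fin, Fintype.card_fin]
    calc K * K * p ≤ p * p * p := by gcongr
      _ = p ^ 3 := by ring)
  have e₅ := hcount A₅ h₅ (by
    rw [Fintype.card_prod, Fintype.card_fin, Fintype.card_fin]
    exact (Nat.mul_le_mul_right p hK).trans hpp)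
  refine (measureReal_mono hsub).trans ?_
  refine (measureReal_union_le _ _).trans ?_
  refine le_trans (add_le_add (measureReal_union_le _ _) hq) ?_
  have u1 := measureReal_union_le (μ := μ) (({G | ∃ k, G ∈ A₁ k} ∪ {G | ∃ k, G ∈ A₂ k})
    ∪ {G | ∃ k, G ∈ A₃ k}) {G | ∃ k, G ∈ A₄ k}
  have u2 := measureReal_union_le (μ := μ) ({G | ∃ k, G ∈ A₁ k} ∪ {G | ∃ k, G ∈ A₂ k})
    {G | ∃ k, G ∈ A₃ k}
  have u3 := measureReal_union_le (μ := μ) {G | ∃ k, G ∈ A₁ k} {G | ∃ k, G ∈ A₂ k}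
  linarith

lemma net_base_le_exp : (1 + 2 / (3 / 10) : ℝ) ≤ Real.exp (51 / 25) := by
  have h1 := Real.exp_one_gt_d9
  have h2 : Real.exp (51 / 25) = Real.exp 1 * Real.exp 1 * Real.exp (1 / 25) := by
    rw [← Real.exp_add, ← Real.exp_add]
    norm_num
  have h3 := Real.add_one_le_exp (1 / 25 : ℝ)
  rw [h2]
  have h4 : (2.7182818283 * 2.7182818283 : ℝ) ≤ Real.exp 1 * Real.exp 1 :=
    mul_le_mul h1.le h1.le (by norm_num) (by positivity)
  have h5 : (2.7182818283 * 2.7182818283 : ℝ) * (1 / 25 + 1)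
      ≤ Real.exp 1 * Real.exp 1 * Real.exp (1 / 25) :=
    mul_le_mul h4 h3 (by norm_num) (by positivity)
  refine le_trans ?_ h5
  norm_num

/-- The deviation of the largest singular value of the matrix of the normalized errors. -/
lemma measureReal_not_operator_le (hn : 0 < n) (hp : 1 ≤ p) {y : ℝ}
    (hy : y = √((p : ℝ) / n) + (p : ℝ) / n) :
    (gaussianDesign n (Fin r ⊕ Fin p)).real {G | ¬ ∀ x : Fin p → ℝ,
      empInner (∑ a, x a • noiseSample G a) (∑ a, x a • noiseSample G a)
        ≤ (1 + 497 / 100 * y) * ∑ a, x a ^ 2} ≤ 400 / p := by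
  have hN : (0 : ℝ) < n := by exact_mod_cast hn
  have hP : (0 : ℝ) < p := by exact_mod_cast hp
  obtain ⟨s, hcard, hs1, hs⟩ :=
    exists_net_sphere (E := EuclideanSpace ℝ (Fin p)) (r := 3 / 10) (by norm_num)
  rw [finrank_euclideanSpace_fin] at hcard
  -- Slightly above the exponent `2.04 p` of the net, `t = 2.045 p` leaves `e^{-p/200}` after the
  -- union bound. The deviation is then at most `4.09 y`, and dividing by the net factor `103/125`
  -- stays below `4.97 y`.
  set t : ℝ := 409 / 200 * p with ht
  have ht0 : 0 ≤ t := by positivity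
  set τ : ℝ := 409 / 100 * y with hτ
  have hτt : 2 * √(n * t) + 2 * t ≤ τ * n := by
    have h1 : √((n : ℝ) * t) ≤ 409 / 200 * (√((p : ℝ) / n) * n) := by
      rw [Real.sqrt_le_left (by positivity)]
      rw [mul_pow, mul_pow, Real.sq_sqrt (by positivity), ht]
      have : (p : ℝ) / n * n ^ 2 = p * n := by field_simp
      rw [this]
      nlinarith [mul_pos hP hN]
    have h2 : (p : ℝ) / n * n = p := by field_simp
    rw [hτ, hy, ht] at *
    nlinarith
  let A : s → Set (Fin n → Fin r ⊕ Fin p → ℝ) := fun u =>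
    {G | τ < |empInner (design G (noiseVec r u.1.ofLp)) (design G (noiseVec r u.1.ofLp)) - 1|}
  have hA : ∀ u, (gaussianDesign n (Fin r ⊕ Fin p)).real (A u) ≤ 2 * Real.exp (-t) := by
    intro u
    refine measureReal_design_unit (ι := Fin r ⊕ Fin p) hn ?_ ht0 hτt
    have h1 := hs1 u.1 u.2
    have h2 := EuclideanSpace.real_norm_sq_eq u.1
    rw [h1] at h2
    rw [noiseVec_dotProduct, dotProduct]
    simp only [← sq]
    rw [← h2, one_pow]
  have hsub : {G : Fin n → Fin r ⊕ Fin p → ℝ | ¬ ∀ x : Fin p → ℝ,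
      empInner (∑ a, x a • noiseSample G a) (∑ a, x a • noiseSample G a)
        ≤ (1 + 497 / 100 * y) * ∑ a, x a ^ 2} ⊆ {G | ∃ u, G ∈ A u} := by
    intro G hG
    by_contra hcon
    refine hG fun x => ?_
    have h1 := empInner_sum_smul_le_of_net (noiseSample G) hs1 hs (τ := τ) (fun u hu => by
      rw [sum_smul_noiseSample]
      exact not_lt.mp fun h => hcon ⟨⟨u, hu⟩, h⟩) x
    refine h1.trans ?_
    have hy0 : 0 ≤ y := by rw [hy]; positivity
    have h2 : 0 ≤ ∑ a, x a ^ 2 := Finset.sum_nonneg fun a _ => sq_nonneg _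
    refine mul_le_mul_of_nonneg_right ?_ h2
    rw [hτ]
    linarith
  refine (measureReal_mono hsub).trans ((measureReal_exists_le _ hA).trans ?_)
  rw [Fintype.card_coe]
  have h1 : (s.card : ℝ) ≤ Real.exp (51 / 25 * p) := by
    refine hcard.trans ?_
    rw [mul_comm, Real.exp_nat_mul]
    exact pow_le_pow_left₀ (by norm_num) net_base_le_exp p
  calc (s.card : ℝ) * (2 * Real.exp (-t)) ≤ Real.exp (51 / 25 * p) * (2 * Real.exp (-t)) := by gcongr
    _ = 2 * Real.exp (-(p / 200)) := by
      rw [mul_left_comm, ← Real.exp_add, ht]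
      congr 2
      ring
    _ ≤ 2 * (200 / p) := by
      rw [Real.exp_neg]
      gcongr
      rw [← inv_div (p : ℝ) 200]
      exact inv_anti₀ (by positivity) (by linarith [Real.add_one_le_exp ((p : ℝ) / 200)])
    _ = _ := by ring

/-- The good event has probability at least `1 - 420 / p`. -/
lemma le_measureReal_isRegularSample (hn : 0 < n) (hp : 1 ≤ p) (hK : K ≤ p) (g : Fin p → Fin K)
    (v : Fin r → Fin K → ℝ) {θ y : ℝ} (hθ0 : 0 ≤ θ)
    (hθ : 2 * √(n * (4 * Real.log p)) + 2 * (4 * Real.log p) ≤ θ * n)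
    (hy : y = √((p : ℝ) / n) + (p : ℝ) / n) :
    1 - 420 / p ≤ (gaussianDesign n (Fin r ⊕ Fin p)).real
      {G | IsRegularSample g (latentDist p v) (latentSample v G) (noiseSample G) θ
        (497 / 100 * y)} := by
  have hP : (0 : ℝ) < p := by exact_mod_cast hp
  have hlog : 0 ≤ 4 * Real.log p := by
    have := Real.log_natCast_nonneg p
    positivity
  have h1 := measureReal_not_regular_le (r := r) hn g v hlog hθ0 hθ hK hp
    (measureReal_not_operator_le hn hp hy)
  have h2 : 20 * (p : ℝ) ^ 3 * Real.exp (-(4 * Real.log p)) = 20 / p := by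
    have h3 : Real.exp (4 * Real.log p) = (p : ℝ) ^ 4 := by
      rw [show (4 : ℝ) * Real.log p = ((4 : ℕ) : ℝ) * Real.log p by norm_num, Real.exp_nat_mul,
        Real.exp_log hP]
    rw [Real.exp_neg, h3]
    field_simp
  have h4 := measureReal_compl (μ := gaussianDesign n (Fin r ⊕ Fin p))
    (isClosed_isRegularSample g (latentDist p v) v θ (497 / 100 * y)).measurableSet
  have h5 : (gaussianDesign n (Fin r ⊕ Fin p)).real Set.univ = 1 := by simp
  rw [h5] at h4
  have h6 : 400 / (p : ℝ) + 20 / p = 420 / p := by ring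
  change (gaussianDesign n (Fin r ⊕ Fin p)).real {G | ¬ IsRegularSample g (latentDist p v)
    (latentSample v G) (noiseSample G) θ (497 / 100 * y)} = _ at h4
  rw [h4, h2] at h1
  linarith

end Regularity

/-! ### Transfer to the observations -/

/-- Two continuous images with the same law: the inner mass of a set of values is transferred. -/
lemma measureReal_le_of_map_eq {Ω Ω' M : Type*} [MeasurableSpace Ω] [MeasurableSpace Ω']
    [TopologicalSpace Ω'] [SigmaCompactSpace Ω'] [OpensMeasurableSpace Ω'] [MeasurableSpace M]
    [TopologicalSpace M] [T2Space M] [BorelSpace M] {P : Measure Ω} {Q : Measure Ω'}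
    [IsProbabilityMeasure P]
    {f : Ω → M} {T : Ω' → M} (hf : AEMeasurable f P) (hT : Continuous T) (h : P.map f = Q.map T)
    {F : Set Ω'} (hF : IsClosed F) {S : Set M} (hFS : ∀ x ∈ F, T x ∈ S) :
    Q.real F ≤ P.real (f ⁻¹' S) := by
  have hFK : F = ⋃ n, F ∩ compactCovering Ω' n := by
    rw [← Set.inter_iUnion, iUnion_compactCovering, Set.inter_univ]
  -- The event about the estimator is not known to be measurable. The image of a closed set is a
  -- countable union of compact sets, hence a measurable set inside it.
  have hmeas : MeasurableSet (T '' F) := by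
    rw [hFK, Set.image_iUnion]
    exact MeasurableSet.iUnion fun n =>
      (((isCompact_compactCovering Ω' n).inter_left hF).image hT).measurableSet
  have h1 : Q F ≤ P (f ⁻¹' S) := by
    calc Q F ≤ Q (T ⁻¹' (T '' F)) := measure_mono (Set.subset_preimage_image T F)
      _ = Q.map T (T '' F) := (Measure.map_apply hT.measurable hmeas).symm
      _ = P.map f (T '' F) := by rw [h]
      _ = P (f ⁻¹' (T '' F)) := Measure.map_apply_of_aemeasurable hf hmeas
      _ ≤ P (f ⁻¹' S) := measure_mono (Set.preimage_mono (by rintro _ ⟨x, hx, rfl⟩; exact hFS x hx))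
  exact ENNReal.toReal_mono (measure_ne_top _ _) h1

section Model

variable {Ω₀ : Type*} [MeasurableSpace Ω₀] {P₀ : Measure Ω₀}
  {n p K r : ℕ} {g : Fin p → Fin K} {X : Ω₀ → Fin p → ℝ} {Z : Ω₀ → Fin K → ℝ} {E : Ω₀ → Fin p → ℝ}

lemma covMatrix_apply {q : ℕ} (Y : Ω₀ → Fin q → ℝ) (a b : Fin q) :
    covMatrix P₀ Y a b = covariance (fun ω => Y ω a) (fun ω => Y ω b) P₀ := rfl

lemma IsGaussianLatentModel.covMatrix_error_ne (h : IsGaussianLatentModel P₀ g X Z E)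
    {a b : Fin p} (hab : a ≠ b) : covMatrix P₀ E a b = 0 :=
  (h.indep_error.indepFun hab).covariance_eq_zero (h.memLp_error a) (h.memLp_error b)

lemma IsGaussianLatentModel.covMatrix_error_self (h : IsGaussianLatentModel P₀ g X Z E)
    (a : Fin p) : covMatrix P₀ E a a = Var[fun ω => E ω a; P₀] :=
  covariance_self (h.memLp_error a).aestronglyMeasurable.aemeasurable

/-- The largest entry of the covariance matrix of the errors is a variance. -/
lemma IsGaussianLatentModel.exists_supNorm_eq (h : IsGaussianLatentModel P₀ g X Z E)
    (hp : 0 < p) : ∃ a, covMatrix P₀ E a a = supNorm (covMatrix P₀ E) := by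
  have : Nonempty (Fin p) := ⟨⟨0, hp⟩⟩
  have h0 : ∀ a, 0 ≤ covMatrix P₀ E a a := fun a => by
    rw [h.covMatrix_error_self]
    exact variance_nonneg _ _
  obtain ⟨a, ha⟩ := Finite.exists_max fun a => covMatrix P₀ E a a
  refine ⟨a, le_antisymm ((le_abs_self _).trans (abs_le_supNorm _ a a)) ?_⟩
  refine supNorm_le (h0 a) fun b c => ?_
  by_cases hbc : b = c
  · subst hbc
    rw [abs_of_nonneg (h0 b)]
    exact ha b
  · rw [h.covMatrix_error_ne hbc, abs_zero]
    exact h0 a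

variable [IsProbabilityMeasure P₀]

lemma covMatrix_posSemidef (hZ : ∀ k, MemLp (fun ω => Z ω k) 2 P₀) :
    (covMatrix P₀ Z).PosSemidef := by
  refine Matrix.PosSemidef.of_dotProduct_mulVec_nonneg ?_ fun x => ?_
  · ext a b
    simp [covMatrix_apply, covariance_comm (fun ω => Z ω b)]
  · have h1 := variance_fun_sum (μ := P₀) (X := fun k ω => Z ω k * x k)
      fun k => (hZ k).mul_const (x k)
    have h2 : star x ⬝ᵥ covMatrix P₀ Z *ᵥ x = Var[fun ω => ∑ k, Z ω k * x k; P₀] := by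
      rw [h1]
      simp only [dotProduct, Matrix.mulVec, star_trivial, Finset.mul_sum, covMatrix_apply,
        covariance_mul_const_left, covariance_mul_const_right]
      exact Finset.sum_congr rfl fun a _ => Finset.sum_congr rfl fun b _ => by ring
    rw [h2]
    exact variance_nonneg _ _

/-- The direction of the `a`-th observed variable. -/
def observedVec (g : Fin p → Fin K) (v : Fin r → Fin K → ℝ) (σ : Fin p → ℝ) (a : Fin p) :
    Fin r ⊕ Fin p → ℝ :=
  latentVec p v (g a) + σ a • noiseVec r (Pi.single a 1)

lemma observedVec_dotProduct (v : Fin r → Fin K → ℝ) (σ : Fin p → ℝ) (a b : Fin p) :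
    observedVec g v σ a ⬝ᵥ observedVec g v σ b
      = ∑ i, v i (g a) * v i (g b) + if a = b then σ a * σ b else 0 := by
  simp only [observedVec, add_dotProduct, dotProduct_add, smul_dotProduct, dotProduct_smul,
    latentVec_dotProduct, latentVec_dotProduct_noiseVec, noiseVec_dotProduct, smul_eq_mul]
  rw [dotProduct_comm, latentVec_dotProduct_noiseVec]
  by_cases h : a = b
  · subst h; simp
  · simp [h, Ne.symm h]

lemma IsGaussianLatentModel.covariance_observed (h : IsGaussianLatentModel P₀ g X Z E)
    (a b : Fin p) : covariance (fun ω => X ω a) (fun ω => X ω b) P₀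
      = covMatrix P₀ Z (g a) (g b) + covMatrix P₀ E a b := by
  have hX : ∀ a, (fun ω => X ω a) = (fun ω => Z ω (g a)) + fun ω => E ω a := fun a =>
    funext fun ω => h.decomposition ω a
  have hZE : ∀ k b, covariance (fun ω => Z ω k) (fun ω => E ω b) P₀ = 0 := fun k b =>
    (h.indep_latent_error.comp (φ := fun z : Fin K → ℝ => z k) (ψ := fun e : Fin p → ℝ => e b)
      (measurable_pi_apply k) (measurable_pi_apply b)).covariance_eq_zero
        (h.memLp_latent k) (h.memLp_error b)
  rw [hX, hX, covariance_add_left (h.memLp_latent _) (h.memLp_error _)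
      ((h.memLp_latent _).add (h.memLp_error _)),
    covariance_add_right (h.memLp_latent _) (h.memLp_latent _) (h.memLp_error _),
    covariance_add_right (h.memLp_error _) (h.memLp_latent _) (h.memLp_error _), hZE,
    covariance_comm (fun ω => E ω a), hZE, covMatrix_apply, covMatrix_apply]
  ring

lemma IsGaussianLatentModel.integral_observed (h : IsGaussianLatentModel P₀ g X Z E) (a : Fin p) :
    ∫ ω, X ω a ∂P₀ = 0 := by
  simp only [h.decomposition]
  rw [integral_add ((h.memLp_latent _).integrable one_le_two)
    ((h.memLp_error _).integrable one_le_two), h.mean_latent, h.mean_error, add_zero]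

/-- The observed vector is distributed as a linear image of a standard Gaussian vector. -/
lemma IsGaussianLatentModel.map_eq (h : IsGaussianLatentModel P₀ g X Z E)
    {v : Fin r → Fin K → ℝ} (hv : ∀ j k, covMatrix P₀ Z j k = ∑ i, v i j * v i k)
    {σ : Fin p → ℝ} (hσ : ∀ a, σ a ^ 2 = covMatrix P₀ E a a) :
    P₀.map X
      = (gaussianRow (Fin r ⊕ Fin p)).map (fun x a => x ⬝ᵥ observedVec g v σ a) := by
  have hT : HasGaussianLaw (fun (x : Fin r ⊕ Fin p → ℝ) a => x ⬝ᵥ observedVec g v σ a)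
      (gaussianRow (Fin r ⊕ Fin p)) := by
    have h1 := hasGaussianLaw_gaussianRow.map_fun
      (ContinuousLinearMap.pi fun a : Fin p => dotProductCLM (observedVec g v σ a))
    have h2 : (fun x : Fin r ⊕ Fin p → ℝ => (ContinuousLinearMap.pi
        fun a : Fin p => dotProductCLM (observedVec g v σ a)) x)
        = fun x a => x ⬝ᵥ observedVec g v σ a := by
      ext x a
      simp [dotProductCLM_apply]
    rwa [h2] at h1
  refine HasGaussianLaw.map_eq_map_of_covariance_eq h.gaussian hT h.integral_observed
    (fun a => integral_dotProduct_gaussianRow _) fun a b => ?_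
  rw [h.covariance_observed, covariance_dotProduct_gaussianRow, observedVec_dotProduct, hv]
  congr 1
  by_cases hab : a = b
  · subst hab
    simp [← hσ, sq]
  · simp [hab, h.covMatrix_error_ne hab]

/-- The sample of the observations is distributed as a linear image of a Gaussian design. -/
lemma IsGaussianLatentModel.map_observations_eq {Ω : Type*} [MeasurableSpace Ω] {P : Measure Ω}
    [IsProbabilityMeasure P] {Xobs : Fin n → Ω → Fin p → ℝ}
    (h : IsGaussianLatentModel P₀ g X Z E) (hind : iIndepFun Xobs P)
    (hid : ∀ i, IdentDistrib (Xobs i) X P P₀)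
    {v : Fin r → Fin K → ℝ} (hv : ∀ j k, covMatrix P₀ Z j k = ∑ i, v i j * v i k)
    {σ : Fin p → ℝ} (hσ : ∀ a, σ a ^ 2 = covMatrix P₀ E a a) :
    P.map (fun ω i => Xobs i ω) = (gaussianDesign n (Fin r ⊕ Fin p)).map
      (fun G i a => G i ⬝ᵥ observedVec g v σ a) := by
  have hm : Measurable fun (x : Fin r ⊕ Fin p → ℝ) (a : Fin p) => x ⬝ᵥ observedVec g v σ a := by
    unfold dotProduct
    fun_prop
  have : IsProbabilityMeasure ((gaussianRow (Fin r ⊕ Fin p)).map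
      fun x a => x ⬝ᵥ observedVec g v σ a) :=
    Measure.isProbabilityMeasure_map hm.aemeasurable
  rw [(iIndepFun_iff_map_fun_eq_pi_map fun i => (hid i).aemeasurable_fst).mp hind, gaussianDesign,
    Measure.pi_map_pi (f := fun (_ : Fin n) (x : Fin r ⊕ Fin p → ℝ) (a : Fin p) =>
      x ⬝ᵥ observedVec g v σ a) fun _ => hm.aemeasurable]
  congr 1
  ext1 i
  rw [(hid i).map_eq, h.map_eq hv hσ]

lemma latentDist_sq_eq {C : Matrix (Fin K) (Fin K) ℝ} {v : Fin r → Fin K → ℝ}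
    (hv : ∀ j k, C j k = ∑ i, v i j * v i k) (j k : Fin K) :
    latentDist p v j k ^ 2 = C k k + C j j - 2 * C j k := by
  rw [latentDist_sq]
  simp only [sub_dotProduct, dotProduct_sub, latentVec_dotProduct, ← hv]
  have hsymm : C k j = C j k := by
    rw [hv, hv]
    exact Finset.sum_congr rfl fun i _ => mul_comm _ _
  rw [hsymm]
  ring

lemma le_of_le_separation {C : Matrix (Fin K) (Fin K) ℝ} (hC : ∀ j k, C j k = C k j) {s : ℝ}
    (hs : (s : EReal) ≤ separation C) {j k : Fin K} (hjk : j ≠ k) :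
    s ≤ C k k + C j j - 2 * C j k := by
  have key : ∀ {j k : Fin K}, j < k → s ≤ C k k + C j j - 2 * C j k := by
    intro j k hlt
    have h1 : separation C ≤ ((C k k + C j j - 2 * C j k : ℝ) : EReal) :=
      (iInf_le _ j).trans ((iInf_le _ k).trans (iInf_le _ hlt))
    exact EReal.coe_le_coe_iff.mp (hs.trans h1)
  rcases lt_or_gt_of_ne hjk with hlt | hlt
  · exact key hlt
  · have := key hlt
    rw [hC k j] at this
    linarith

lemma minGroupSize_le (g : Fin p → Fin K) (k : Fin K) : minGroupSize g ≤ groupSize g k :=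
  ciInf_le (OrderBot.bddBelow _) k

lemma exists_index_of_groupSize_pos {k : Fin K} (hk : 0 < groupSize g k) : ∃ a, g a = k := by
  obtain ⟨a, ha⟩ := Finset.card_pos.mp hk
  exact ⟨a, (Finset.mem_filter.mp ha).2⟩

end Model

/-! ### Numerical constants -/

section Numerics

variable {n p : ℕ}

/-- The constant is `80000²`, which after taking roots yields `100 θ = 800 √(log p / n) ≤ y / 100`
in `noiseLevel_bounds`. -/
lemma log_le_of_large (hp : (10 : ℝ) ^ 21 ≤ p) : 6400000000 * Real.log p ≤ p := by
  have hP : (0 : ℝ) < p := lt_of_lt_of_le (by norm_num) hp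
  have h1 : (30000000000 : ℝ) ≤ √p := Real.le_sqrt_of_sq_le (le_trans (by norm_num) hp)
  have h2 : Real.log p = 2 * Real.log √p := by
    rw [Real.log_sqrt hP.le]; ring
  have h3 : Real.log √p ≤ √p := (Real.log_le_sub_one_of_pos (by positivity)).trans (by linarith)
  have h4 : √(p : ℝ) * √p = p := Real.mul_self_sqrt hP.le
  nlinarith

lemma noiseLevel_bounds (hn : 0 < n) (hp : (10 : ℝ) ^ 21 ≤ p)
    (hlog : Real.log p ≤ 1 / 10 ^ 12 * n) {θ : ℝ} (hθ : θ = 8 * √(Real.log p / n)) :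
    2 * √(n * (4 * Real.log p)) + 2 * (4 * Real.log p) ≤ θ * n ∧ θ ≤ 1 / 100000 ∧
      100 * θ ≤ 1 / 100 * (√((p : ℝ) / n) + (p : ℝ) / n) := by
  have hN : (0 : ℝ) < n := by exact_mod_cast hn
  have hP : (0 : ℝ) < p := lt_of_lt_of_le (by norm_num) hp
  have hl0 : 0 ≤ Real.log p := Real.log_natCast_nonneg p
  set q := √(Real.log p / n) with hq
  have hq0 : 0 ≤ q := Real.sqrt_nonneg _
  have hqq : q ^ 2 = Real.log p / n := Real.sq_sqrt (by positivity)
  have hqn : Real.log p = q ^ 2 * n := by rw [hqq]; field_simp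
  have hq1 : q ≤ 1 / 1000000 := by
    rw [hq, Real.sqrt_le_left (by norm_num), div_le_iff₀ hN]
    norm_num at hlog ⊢
    linarith
  refine ⟨?_, ?_, ?_⟩
  · have h1 : √((n : ℝ) * (4 * Real.log p)) = 2 * q * n := by
      rw [hqn, show (n : ℝ) * (4 * (q ^ 2 * n)) = (2 * q * n) ^ 2 by ring,
        Real.sqrt_sq (by positivity)]
    rw [h1, hθ, hqn]
    have h2 : q ^ 2 * n ≤ 1 / 1000000 * (q * n) := by
      have := mul_le_mul_of_nonneg_right hq1 (by positivity : 0 ≤ q * n)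
      linarith
    have h3 : 0 ≤ q * n := by positivity
    linarith
  · rw [hθ]; linarith
  · have h1 : 80000 * q ≤ √((p : ℝ) / n) := by
      apply Real.le_sqrt_of_sq_le
      rw [mul_pow, hqq, ← mul_div_assoc]
      gcongr
      have := log_le_of_large hp
      norm_num
      linarith
    have h2 : 0 ≤ (p : ℝ) / n := by positivity
    rw [hθ]
    linarith

/-- The largest coefficient is `3000 · 64 = 192000`, from `θ²`; strictness comes from the term `log
p / n`, which is positive. -/
lemma separation_rate_lt (hn : 0 < n) (hl : 0 < Real.log p) {m : ℝ} (hm : 0 < m) {θ y : ℝ}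
    (hθ : θ = 8 * √(Real.log p / n)) (hy : y = √((p : ℝ) / n) + (p : ℝ) / n) :
    3000 * (θ ^ 2 + θ / √m + y / m)
      < 200000 * (√(Real.log p / (m * n)) + √(p / (n * m ^ 2)) + Real.log p / n + p / (n * m)) := by
  have hN : (0 : ℝ) < n := by exact_mod_cast hn
  have h1 : θ ^ 2 = 64 * (Real.log p / n) := by
    rw [hθ, mul_pow, Real.sq_sqrt (by positivity)]; norm_num
  have h2 : √(Real.log p / (m * n)) = √(Real.log p / n) / √m := by
    rw [← Real.sqrt_div (by positivity), div_div, mul_comm m]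
  have h3 : √((p : ℝ) / (n * m ^ 2)) = √((p : ℝ) / n) / m := by
    rw [← div_div, Real.sqrt_div (by positivity), Real.sqrt_sq hm.le]
  have h4 : (p : ℝ) / (n * m) = p / n / m := by rw [div_div]
  have h5 : θ / √m = 8 * (√(Real.log p / n) / √m) := by rw [hθ]; ring
  have h6 : y / m = √((p : ℝ) / n) / m + p / n / m := by rw [hy]; ring
  rw [h1, h2, h3, h4, h5, h6]
  have e1 : 0 < Real.log p / n := by positivity
  have e2 : 0 ≤ √(Real.log p / n) / √m := by positivity
  have e3 : 0 ≤ √((p : ℝ) / n) / m := by positivity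
  have e4 : 0 ≤ (p : ℝ) / n / m := by positivity
  linarith

end Numerics

end VariableClustering

end

/-! ### Assembly of the main theorem -/

open VariableClustering in
theorem mainTheorem5 :
    ∃ c₁ c₂ c₃ : ℝ, 0 < c₁ ∧ 0 < c₂ ∧ 0 < c₃ ∧
      ∀ (n p K : ℕ) (g : Fin p → Fin K)
        -- the random vector `X` and its latent decomposition
        (Ω₀ : Type*) [MeasurableSpace Ω₀] (P₀ : Measure Ω₀) [IsProbabilityMeasure P₀]
        (X : Ω₀ → Fin p → ℝ) (Z : Ω₀ → Fin K → ℝ) (E : Ω₀ → Fin p → ℝ)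
        -- the observations
        (Ω : Type*) [MeasurableSpace Ω] (P : Measure Ω) [IsProbabilityMeasure P]
        (Xobs : Fin n → Ω → Fin p → ℝ),
        VariableClustering.IsGaussianLatentModel P₀ g X Z E →
        iIndepFun Xobs P →
        (∀ i, IdentDistrib (Xobs i) X P P₀) →
        3 ≤ VariableClustering.minGroupSize g →
        VariableClustering.covMatrix P₀ E ≠ 0 →
        Real.log p ≤ c₁ * n →
        ((c₂ * VariableClustering.supNorm (VariableClustering.covMatrix P₀ E) *
            (√(Real.log p / (VariableClustering.minGroupSize g * n))
              + √(p / (n * (VariableClustering.minGroupSize g : ℝ) ^ 2))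
              + Real.log p / n
              + p / (n * VariableClustering.minGroupSize g)) : ℝ) : EReal)
          ≤ VariableClustering.separation (VariableClustering.covMatrix P₀ Z) →
        1 - c₃ / p ≤ P.real {ω | VariableClustering.adaptiveEstimators
            (Matrix.of fun i a => Xobs i ω a : Matrix (Fin n) (Fin p) ℝ)
              = {VariableClustering.partnership g}} := by
  refine ⟨1 / 10 ^ 12, 200000, 10 ^ 21, by norm_num, by norm_num, by norm_num, ?_⟩
  intro n p K g Ω₀ _ P₀ _ X Z E Ω _ P _ Xobs hmodel hind hid hm3 hΓ hlog hsep
  by_cases hp : (p : ℝ) < 10 ^ 21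
  · refine le_trans ?_ measureReal_nonneg
    -- For `p = 0` the bound is not vacuous, as `c₃ / 0 = 0`; but then `Γ` is an empty matrix, hence
    -- zero, which is excluded.
    rcases Nat.eq_zero_or_pos p with rfl | hp0
    · have hcov : VariableClustering.covMatrix P₀ E = 0 := by
        ext a
        exact a.elim0
      exact absurd hcov hΓ
    · have hP : (0 : ℝ) < p := by exact_mod_cast hp0
      rw [sub_nonpos, one_le_div hP]
      exact hp.le
  have hp : (10 : ℝ) ^ 21 ≤ p := not_lt.mp hp
  have hP : (0 : ℝ) < p := lt_of_lt_of_le (by norm_num) hp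
  have hp3 : 3 ≤ p := by
    have : ((3 : ℕ) : ℝ) ≤ p := le_trans (by norm_num) hp
    exact_mod_cast this
  have hl : 0 < Real.log p := Real.log_pos (lt_of_lt_of_le (by norm_num) hp)
  have hn : 0 < n := by
    rcases Nat.eq_zero_or_pos n with rfl | h
    · norm_num at hlog
      linarith
    · exact h
  have hg : ∀ k, 3 ≤ groupSize g k := fun k => hm3.trans (minGroupSize_le g k)
  have hK : K ≤ p := by
    have hsurj : Function.Surjective g := fun k =>
      exists_index_of_groupSize_pos (lt_of_lt_of_le (by norm_num) (hg k))
    simpa using Fintype.card_le_of_surjective g hsurj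
  obtain ⟨r, v, hv⟩ := (covMatrix_posSemidef hmodel.memLp_latent).exists_gram
  have hvar0 : ∀ a, 0 ≤ covMatrix P₀ E a a := fun a => by
    rw [hmodel.covMatrix_error_self]
    exact variance_nonneg _ _
  set σ : Fin p → ℝ := fun a => √(covMatrix P₀ E a a) with hσdef
  have hσ : ∀ a, σ a ^ 2 = covMatrix P₀ E a a := fun a => Real.sq_sqrt (hvar0 a)
  have hlaw := hmodel.map_observations_eq hind hid hv hσ
  set s := supNorm (covMatrix P₀ E) with hs
  have hs0 : 0 < s := by
    by_contra hcon
    refine hΓ ?_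
    ext a b
    have h1 := (abs_le_supNorm (covMatrix P₀ E) a b).trans (not_lt.mp hcon)
    simpa using h1
  obtain ⟨θ, hθ⟩ : ∃ θ, θ = 8 * √(Real.log p / n) := ⟨_, rfl⟩
  obtain ⟨y, hy⟩ : ∃ y, y = √((p : ℝ) / n) + (p : ℝ) / n := ⟨_, rfl⟩
  have hθ0 : 0 ≤ θ := by rw [hθ]; positivity
  obtain ⟨hθ1, hθ2, hθ3⟩ := noiseLevel_bounds hn hp hlog hθ
  rw [← hy] at hθ3
  have hm0 : (0 : ℝ) < minGroupSize g := by exact_mod_cast (by omega : 0 < minGroupSize g)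
  have hprob := le_measureReal_isRegularSample hn (by omega) hK g v hθ0 hθ1 hy
  have htransfer := measureReal_le_of_map_eq (f := fun ω i => Xobs i ω)
    (T := fun G i a => G i ⬝ᵥ observedVec g v σ a)
    (aemeasurable_pi_lambda _ fun i => (hid i).aemeasurable_fst)
    (by unfold dotProduct; fun_prop) hlaw
    (isClosed_isRegularSample g (latentDist p v) v θ (497 / 100 * y))
    (S := {Y | adaptiveEstimators (Matrix.of Y : Matrix (Fin n) (Fin p) ℝ) = {partnership g}})
    (by
      intro G hG
      have hG : IsRegularSample g (latentDist p v) (latentSample v G) (noiseSample G) θ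
        (497 / 100 * y) := hG
      -- `S = √|Γ|_∞` is attained by some `σ_a`, because `Γ` is diagonal with nonnegative entries.
      refine hG.adaptiveEstimators_eq (σ := σ) (S := √s) (m := minGroupSize g) hy hn hp3 ?_ ?_ ?_
        ?_ ?_ ?_ ?_ ?_ ?_ hg hθ0 hθ2 hθ3 ?_
      · intro a
        change design G (observedVec g v σ a) = _
        rw [observedVec, design_add, design_smul]
        rfl
      · exact fun a => Real.sqrt_nonneg _
      · exact fun a => Real.sqrt_le_sqrt ((le_abs_self _).trans (abs_le_supNorm _ a a))
      · exact Real.sqrt_pos.mpr hs0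
      · obtain ⟨a, ha⟩ := hmodel.exists_supNorm_eq (by omega)
        exact ⟨a, by rw [hσdef, hs, ← ha]⟩
      · intro a b hab
        simp only [hσdef, hmodel.covMatrix_error_self, hmodel.variance_error a b hab]
      · exact fun j k => Real.sqrt_nonneg _
      · exact_mod_cast (by omega : 1 ≤ minGroupSize g)
      · exact fun k => by exact_mod_cast minGroupSize_le g k
      · intro j k hjk
        rw [latentDist_sq_eq hv, Real.sq_sqrt hs0.le]
        refine lt_of_lt_of_le ?_ (le_of_le_separation (fun j k => ?_) hsep hjk)
        · have h1 := separation_rate_lt hn hl hm0 hθ hy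
          calc _ < s * _ := mul_lt_mul_of_pos_left h1 hs0
            _ = _ := by ring
        · rw [covMatrix_apply, covMatrix_apply, covariance_comm])
  refine le_trans ?_ (hprob.trans htransfer)
  have : 420 / (p : ℝ) ≤ 10 ^ 21 / p := by
    gcongr
    norm_num
  linarith
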